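/- Let $\mathbb K$ be $\mathbb R$ or $\mathbb C$. For a Banach space $X$ over $\mathbb K$, let $\mathrm{Lip}_0(X)$ be the set of Lipschitz maps $T\colon X\to X$ with $T(0)=0$, with $\|T\|_L=\sup\{\|Tx-Ty\|/\|x-y\| : x\neq y\}$, and for $x\in X$ let $D(x)=\{x^*\in X^* : x^*(x)=\|x^*\|\,\|x\|=\|x\|^2\}$. The numerical radius of $T\in\mathrm{Lip}_0(X)$ is $$\omega(T)=\sup\Big\{\frac{|x^*(Tx-Ty)|}{\|x-y\|^2} : x,y\in X,\ x\neq y,\ x^*\in D(x-y)\Big\},$$ and the Lipschitz numerical index of $X$ is $n_L(X)=\inf\{\omega(T) : T\in\mathrm{Lip}_0(X),\ \|T\|_L=1\}$. Theorem. Let $(\Omega,\Sigma,\nu)$ be a $\sigma$-finite measure space with $\nu\neq 0$, and let $X$ be a Banach space over $\mathbb K$. Let $L_\infty(\nu,X)$ be the Banach space of (classes of) essentially bounded strongly measurable functions $\Omega\to X$ with the essential supremum norm. Then $$n_L(L_\infty(\nu,X))=n_L(X).$$ (If $X=\{0\}$, both sides are the infimum of the empty set, with the same conventional value.) Moreover,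 for scalar-valued function spaces over $\mathbb K$: $n_L(C(K))=1$ for every non-empty compact Hausdorff space $K$; $n_L(L_1(\mu))=1$ for every positive measure $\mu$, not necessarily $\sigma$-finite, with $L_1(\mu)\neq\{0\}$; and $n_L(L_\infty(\nu))=1$ for every $\sigma$-finite measure $\nu\neq 0$. -/

import Mathlib

open MeasureTheory
open scoped ENNReal NNReal

noncomputable section

/-- `Lip₀(X)`: the Lipschitz self-maps of `X` that send `0` to `0`. -/
def LipZero (X : Type*) [NormedAddCommGroup X] : Set (X → X) :=
  {T | (∃ M : ℝ≥0, LipschitzWith M T) ∧ T 0 = 0}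

/-- The Lipschitz norm `‖T‖_L = sup {‖T x - T y‖ / ‖x - y‖ : x ≠ y}`
(a genuine supremum whenever `T` is Lipschitz). -/
def lipNorm {X : Type*} [NormedAddCommGroup X] (T : X → X) : ℝ :=
  sSup {r : ℝ | ∃ x y : X, x ≠ y ∧ r = ‖T x - T y‖ / ‖x - y‖}

/-- `D(x) = {x* ∈ X* : x*(x) = ‖x*‖ ‖x‖ = ‖x‖²}`. -/
def dualitySet (𝕜 : Type*) [RCLike 𝕜] {X : Type*} [NormedAddCommGroup X] [NormedSpace 𝕜 X]
    (x : X) : Set (StrongDual 𝕜 X) :=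
  {f | f x = ((‖f‖ * ‖x‖ : ℝ) : 𝕜) ∧ ‖f‖ * ‖x‖ = ‖x‖ ^ 2}

/-- The numerical range `W(T) = {(x-y)*(T x - T y) / ‖x - y‖² : x ≠ y, (x-y)* ∈ D(x-y)}`. -/
def lipNumericalRange (𝕜 : Type*) [RCLike 𝕜] {X : Type*} [NormedAddCommGroup X]
    [NormedSpace 𝕜 X] (T : X → X) : Set 𝕜 :=
  {c | ∃ x y : X, x ≠ y ∧ ∃ f ∈ dualitySet 𝕜 (x - y),
    c = f (T x - T y) / ((‖x - y‖ ^ 2 : ℝ) : 𝕜)}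

/-- The numerical radius `ω(T) = sup {|c| : c ∈ W(T)}`
(a genuine supremum whenever `T` is Lipschitz: the set is bounded by `‖T‖_L`). -/
def lipNumericalRadius (𝕜 : Type*) [RCLike 𝕜] {X : Type*} [NormedAddCommGroup X]
    [NormedSpace 𝕜 X] (T : X → X) : ℝ :=
  sSup {r : ℝ | ∃ c ∈ lipNumericalRange 𝕜 T, r = ‖c‖}

/-- The Lipschitz numerical index `n_L(X) = inf {ω(T) : T ∈ Lip₀(X), ‖T‖_L = 1}`
(a genuine infimum whenever `X ≠ {0}`). -/
def lipNumericalIndex (𝕜 : Type*) [RCLike 𝕜] (X : Type*) [NormedAddCommGroup X]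
    [NormedSpace 𝕜 X] : ℝ :=
  sInf {r : ℝ | ∃ T ∈ LipZero X, lipNorm T = 1 ∧ r = lipNumericalRadius 𝕜 T}

end

/-! ### The Lipschitz norm -/

section LipschitzNorm

variable {X : Type*} [NormedAddCommGroup X] {T : X → X}

/-! The engine is a first-order estimate. If `w = x - y + θ(Tx - Ty)` with `‖θ‖ ≤ α`, a functional
norming `w` norms the difference of the shifted point `x + θ(Tx - Ty)` and `y`. The numerical radius
therefore applies there, and undoing the shift costs only `O(α²)`. Hence `‖w‖ ≤ (1 + α ω(T) + O(α²))
‖x - y‖` (`norm_sub_add_smul_le`). Choosing the phase of `θ`, every `f` in the dual unit ball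
satisfies `|f(x - y)| + α |f(Tx - Ty)| ≤ (1 + α ω(T) + O(α²)) ‖x - y‖`, so functionals that only
almost norm `x - y` are controlled too.

For `C(K)`, `L₁` and the scalar field the index is `1` by lushness: `x - y` is a sum of vectors of
almost the same total norm, each almost normed up to rotation by one `f` that also almost norms `Tx
- Ty`. Walking from `y` to `x` along these vectors gives `‖Tx - Ty‖ ≤ ω(T) ‖x - y‖`
(`IsLush.lipNorm_le_lipNumericalRadius`).

For `L∞(ν, X)`, composition with `T : X → X` preserves the Lipschitz norm and, since the first-order
estimate holds pointwise, does not increase the numerical radius. This gives `≤`. For `≥`, a map `T`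
on `L∞(ν, X)` is compressed to `S = P ∘ T ∘ Φ` on `X`, up to a constant, where `Φ` is a nonlinear
isometry prescribing values on a set `B` and `P` averages over part of `B`. As `P(Φx - Φy) = x - y`,
norming functionals pull back and `ω(S) ≤ ω(T)`. Perturbation and a detour supply functions through
which `Φ` can pass and which `T` separates by nearly its Lipschitz norm, so `‖S‖_L` is almost
`‖T‖_L` (`lipNumericalIndex_mul_le_of_const_on`). -/

lemma norm_sub_le_lipNorm_mul (hT : T ∈ LipZero X) (x y : X) :
    ‖T x - T y‖ ≤ lipNorm T * ‖x - y‖ := by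
  obtain ⟨⟨M, hM⟩, -⟩ := hT
  rcases eq_or_ne x y with rfl | hxy
  · simp
  have hpos : 0 < ‖x - y‖ := norm_pos_iff.2 (sub_ne_zero.2 hxy)
  rw [← div_le_iff₀ hpos]
  refine le_csSup ⟨M, ?_⟩ ⟨x, y, hxy, rfl⟩
  rintro r ⟨a, b, hab, rfl⟩
  rw [div_le_iff₀ (norm_pos_iff.2 (sub_ne_zero.2 hab))]
  exact hM.norm_sub_le a b

lemma lipNorm_nonneg (T : X → X) : 0 ≤ lipNorm T := by
  apply Real.sSup_nonneg
  rintro r ⟨x, y, -, rfl⟩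
  positivity

lemma lipNorm_le {c : ℝ} (hc : 0 ≤ c) (h : ∀ x y, ‖T x - T y‖ ≤ c * ‖x - y‖) :
    lipNorm T ≤ c := by
  refine Real.sSup_le ?_ hc
  rintro r ⟨x, y, hxy, rfl⟩
  rw [div_le_iff₀ (norm_pos_iff.2 (sub_ne_zero.2 hxy))]
  exact h x y

lemma mem_lipZero_of_norm_sub_le {c : ℝ} (hc : 0 ≤ c) (h0 : T 0 = 0)
    (h : ∀ x y, ‖T x - T y‖ ≤ c * ‖x - y‖) : T ∈ LipZero X :=
  ⟨⟨⟨c, hc⟩, LipschitzWith.of_dist_le_mul fun x y => by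
    rw [dist_eq_norm, dist_eq_norm]
    exact h x y⟩, h0⟩

lemma exists_lt_norm_sub_of_lt_lipNorm {c : ℝ} (hc : 0 ≤ c) (h : c < lipNorm T) :
    ∃ x y : X, x ≠ y ∧ c * ‖x - y‖ < ‖T x - T y‖ := by
  by_contra! hcon
  refine h.not_ge (lipNorm_le hc fun x y => ?_)
  rcases eq_or_ne x y with rfl | hxy
  · simp
  · exact hcon x y hxy

end LipschitzNorm

/-! ### Numerical radius, first-order estimates and elementary properties of the index -/

section LipschitzNumericalRadius

variable {𝕜 : Type*} [RCLike 𝕜] {X : Type*} [NormedAddCommGroup X] [NormedSpace 𝕜 X] {T : X → X}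

lemma lipNumericalRadius_nonneg (T : X → X) : 0 ≤ lipNumericalRadius 𝕜 T := by
  apply Real.sSup_nonneg
  rintro r ⟨c, -, rfl⟩
  positivity

lemma norm_eq_of_mem_dualitySet {x : X} (hx : x ≠ 0) {f : StrongDual 𝕜 X}
    (hf : f ∈ dualitySet 𝕜 x) : ‖f‖ = ‖x‖ := by
  have hpos : 0 < ‖x‖ := norm_pos_iff.2 hx
  have h2 := hf.2
  rw [sq] at h2
  exact mul_right_cancel₀ hpos.ne' h2

lemma lipNumericalRadius_le {c : ℝ} (hc : 0 ≤ c)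
    (h : ∀ x y : X, x ≠ y → ∀ f : StrongDual 𝕜 X, ‖f‖ = ‖x - y‖ →
      f (x - y) = ((‖x - y‖ ^ 2 : ℝ) : 𝕜) → ‖f (T x - T y)‖ ≤ c * ‖x - y‖ ^ 2) :
    lipNumericalRadius 𝕜 T ≤ c := by
  refine Real.sSup_le ?_ hc
  rintro r ⟨z, ⟨x, y, hxy, f, hf, rfl⟩, rfl⟩
  have hpos : 0 < ‖x - y‖ := norm_pos_iff.2 (sub_ne_zero.2 hxy)
  rw [norm_div, RCLike.norm_ofReal, abs_of_nonneg (by positivity), div_le_iff₀ (by positivity)]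
  refine h x y hxy f (norm_eq_of_mem_dualitySet (sub_ne_zero.2 hxy) hf) ?_
  rw [hf.1, hf.2]

lemma norm_apply_sub_le_of_mem_dualitySet (hT : T ∈ LipZero X) {x y : X} {f : StrongDual 𝕜 X}
    (hf : f ∈ dualitySet 𝕜 (x - y)) :
    ‖f (T x - T y)‖ ≤ lipNumericalRadius 𝕜 T * ‖x - y‖ ^ 2 := by
  rcases eq_or_ne x y with rfl | hxy
  · simp
  have hpos : 0 < ‖x - y‖ := norm_pos_iff.2 (sub_ne_zero.2 hxy)
  have key : ∀ {x y : X}, x ≠ y → ∀ {f : StrongDual 𝕜 X}, f ∈ dualitySet 𝕜 (x - y) →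
      ‖f (T x - T y) / ((‖x - y‖ ^ 2 : ℝ) : 𝕜)‖ ≤ lipNorm T := by
    intro x y hxy f hf
    have hpos : 0 < ‖x - y‖ := norm_pos_iff.2 (sub_ne_zero.2 hxy)
    rw [norm_div, RCLike.norm_ofReal, abs_of_nonneg (by positivity), div_le_iff₀ (by positivity)]
    calc ‖f (T x - T y)‖ ≤ ‖f‖ * ‖T x - T y‖ := f.le_opNorm _
      _ ≤ ‖x - y‖ * (lipNorm T * ‖x - y‖) := by
        rw [norm_eq_of_mem_dualitySet (sub_ne_zero.2 hxy) hf]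
        gcongr
        exact norm_sub_le_lipNorm_mul hT x y
      _ = lipNorm T * ‖x - y‖ ^ 2 := by ring
  have : ‖f (T x - T y) / ((‖x - y‖ ^ 2 : ℝ) : 𝕜)‖ ≤ lipNumericalRadius 𝕜 T := by
    refine le_csSup ⟨lipNorm T, ?_⟩ ⟨_, ⟨x, y, hxy, f, hf, rfl⟩, rfl⟩
    rintro r ⟨z, ⟨a, b, hab, g, hg, rfl⟩, rfl⟩
    exact key hab hg
  rwa [norm_div, RCLike.norm_ofReal, abs_of_nonneg (by positivity),
    div_le_iff₀ (by positivity)] at this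

lemma norm_apply_sub_le_of_norming (hT : T ∈ LipZero X) {x y : X} {f : StrongDual 𝕜 X}
    (hf : ‖f‖ = 1) (hxy : f (x - y) = (‖x - y‖ : 𝕜)) :
    ‖f (T x - T y)‖ ≤ lipNumericalRadius 𝕜 T * ‖x - y‖ := by
  rcases eq_or_ne x y with rfl | hne
  · simp
  have hpos : 0 < ‖x - y‖ := norm_pos_iff.2 (sub_ne_zero.2 hne)
  have h := norm_apply_sub_le_of_mem_dualitySet (𝕜 := 𝕜) hT (x := x) (y := y)
    (f := (‖x - y‖ : 𝕜) • f) ⟨by simp [norm_smul, hf, hxy], by simp [norm_smul, hf, sq]⟩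
  rw [smul_apply, norm_smul, RCLike.norm_ofReal, abs_norm] at h
  nlinarith

lemma lipNumericalRadius_le_lipNorm (hT : T ∈ LipZero X) :
    lipNumericalRadius 𝕜 T ≤ lipNorm T := by
  refine lipNumericalRadius_le (lipNorm_nonneg T) fun x y _ f hf _ => ?_
  calc ‖f (T x - T y)‖ ≤ ‖f‖ * ‖T x - T y‖ := f.le_opNorm _
    _ ≤ ‖x - y‖ * (lipNorm T * ‖x - y‖) := by
      rw [hf]
      gcongr
      exact norm_sub_le_lipNorm_mul hT x y
    _ = lipNorm T * ‖x - y‖ ^ 2 := by ring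

/-- Adding a small multiple of `T` to the identity increases norms by at most the numerical
radius, to first order. -/
lemma norm_sub_add_smul_le (hT : T ∈ LipZero X) {L c : ℝ} (hL : lipNorm T ≤ L)
    (hc : lipNumericalRadius 𝕜 T ≤ c) {α : ℝ} (hα : 0 ≤ α) (hαc : α * c < 1) {θ : 𝕜}
    (hθ : ‖θ‖ ≤ α) (x y : X) :
    ‖x - y + θ • (T x - T y)‖ ≤ (1 + α ^ 2 * L ^ 2) / (1 - α * c) * ‖x - y‖ := by
  have hL0 : 0 ≤ L := (lipNorm_nonneg T).trans hL
  have hc0 : 0 ≤ c := (lipNumericalRadius_nonneg (𝕜 := 𝕜) T).trans hc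
  set w := x - y + θ • (T x - T y) with hw
  rcases eq_or_ne w 0 with h0 | h0
  · rw [h0, norm_zero]
    have : 0 < 1 - α * c := by linarith
    positivity
  obtain ⟨g, hg1, hgw⟩ := exists_dual_vector 𝕜 w (norm_ne_zero_iff.2 h0)
  -- The shift makes `x' - y = w`, so `g`, which norms `w`, is admissible for the pair `(x', y)`.
  set x' := x + θ • (T x - T y) with hx'
  have hxw : x' - y = w := by rw [hx', hw]; abel
  have hT' : ∀ a b, ‖T a - T b‖ ≤ L * ‖a - b‖ := fun a b =>
    (norm_sub_le_lipNorm_mul hT a b).trans (by gcongr)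
  have h1 : ‖g (T x' - T y)‖ ≤ c * ‖w‖ := by
    have := norm_apply_sub_le_of_norming hT (x := x') (y := y) hg1 (by rw [hxw, hgw])
    rw [hxw] at this
    exact this.trans (by gcongr)
  have h2 : ‖T x - T x'‖ ≤ L * (α * (L * ‖x - y‖)) := by
    refine (hT' _ _).trans ?_
    rw [hx', sub_add_cancel_left, norm_neg, norm_smul]
    gcongr
    exact hT' x y
  have h3 : ‖w‖ ≤ ‖x - y‖ + α * (c * ‖w‖ + L * (α * (L * ‖x - y‖))) := by
    have e : g w = g (x - y) + θ * (g (T x' - T y) + g (T x - T x')) := by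
      rw [← map_add, add_comm (T x' - T y), sub_add_sub_cancel, hw, map_add, map_smul, smul_eq_mul]
    have hgl : ∀ z, ‖g z‖ ≤ ‖z‖ := fun z => by simpa [hg1] using g.le_opNorm z
    calc ‖w‖ = ‖g w‖ := by rw [hgw, RCLike.norm_ofReal, abs_norm]
      _ ≤ ‖g (x - y)‖ + ‖θ‖ * (‖g (T x' - T y)‖ + ‖g (T x - T x')‖) := by
        rw [e]
        refine (norm_add_le _ _).trans ?_
        rw [norm_mul]
        gcongr
        exact norm_add_le _ _
      _ ≤ _ := by
        gcongr
        · exact hgl _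
        · exact (hgl _).trans h2
  rw [div_mul_eq_mul_div, le_div_iff₀ (by linarith)]
  nlinarith

lemma exists_norm_add_mul_eq {α : ℝ} (hα : 0 ≤ α) (z w : 𝕜) :
    ∃ u : 𝕜, ‖u‖ ≤ α ∧ ‖z + u * w‖ = ‖z‖ + α * ‖w‖ := by
  obtain ⟨a, ha, ha'⟩ := RCLike.exists_norm_mul_eq_self z
  obtain ⟨b, hb, hb'⟩ := RCLike.exists_norm_eq_mul_self w
  refine ⟨α * (a * b), by simp [ha, hb, abs_of_nonneg hα], ?_⟩
  have e : z + (α : 𝕜) * (a * b) * w = a * ((‖z‖ + α * ‖w‖ : ℝ) : 𝕜) := by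
    rw [RCLike.ofReal_add, RCLike.ofReal_mul]
    linear_combination (-1 : 𝕜) * ha' - (α : 𝕜) * a * hb'
  rw [e, norm_mul, ha, one_mul, RCLike.norm_ofReal, abs_of_nonneg (by positivity)]

/-- Every functional in the unit ball controls a Lipschitz map through its numerical radius. -/
lemma norm_apply_add_mul_norm_apply_le (hT : T ∈ LipZero X) {L c : ℝ} (hL : lipNorm T ≤ L)
    (hc : lipNumericalRadius 𝕜 T ≤ c) {α : ℝ} (hα : 0 ≤ α) (hαc : α * c < 1)
    {f : StrongDual 𝕜 X} (hf : ‖f‖ ≤ 1) (x y : X) :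
    ‖f (x - y)‖ + α * ‖f (T x - T y)‖ ≤ (1 + α ^ 2 * L ^ 2) / (1 - α * c) * ‖x - y‖ := by
  obtain ⟨u, hu, hu'⟩ := exists_norm_add_mul_eq hα (f (x - y)) (f (T x - T y))
  rw [← hu']
  calc ‖f (x - y) + u * f (T x - T y)‖
      = ‖f (x - y + u • (T x - T y))‖ := by rw [map_add, map_smul, smul_eq_mul]
    _ ≤ ‖x - y + u • (T x - T y)‖ := by
      simpa using f.le_of_opNorm_le hf (x - y + u • (T x - T y))
    _ ≤ _ := norm_sub_add_smul_le hT hL hc hα hαc hu x y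

/-- First-order comparison as `α → 0⁺`. -/
lemma le_mul_of_forall_add_mul_le {a b c L : ℝ}
    (h : ∀ α : ℝ, 0 < α → α * c < 1 → a + α * b ≤ (1 + α ^ 2 * L ^ 2) / (1 - α * c) * a) :
    b ≤ c * a := by
  -- Clearing the denominator, cancelling `a` and dividing by `α` turns the hypothesis into `b (1 -
  -- α c) - α L² a ≤ c a`.
  have h2 : Filter.Tendsto (fun α : ℝ => b * (1 - α * c) - α * L ^ 2 * a)
      (nhdsWithin 0 (Set.Ioi 0)) (nhds (b * (1 - 0 * c) - 0 * L ^ 2 * a)) :=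
    ((by fun_prop : Continuous fun α : ℝ => b * (1 - α * c) - α * L ^ 2 * a).tendsto 0).mono_left
      nhdsWithin_le_nhds
  have hev : ∀ᶠ α : ℝ in nhdsWithin 0 (Set.Ioi 0), α * c < 1 := by
    refine Filter.Eventually.filter_mono nhdsWithin_le_nhds ?_
    exact (by fun_prop : Continuous fun α : ℝ => α * c).tendsto 0 |>.eventually
      (gt_mem_nhds (by simp))
  simp only [zero_mul, sub_zero, mul_one] at h2
  refine le_of_tendsto h2 ?_
  filter_upwards [hev, self_mem_nhdsWithin] with α h1 h3
  have h4 := h α h3 h1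
  rw [div_mul_eq_mul_div, le_div_iff₀ (by linarith)] at h4
  refine le_of_mul_le_mul_left ?_ (Set.mem_Ioi.1 h3)
  nlinarith

lemma smul_mem_lipZero (hT : T ∈ LipZero X) (a : 𝕜) : a • T ∈ LipZero X := by
  refine mem_lipZero_of_norm_sub_le (c := ‖a‖ * lipNorm T)
    (mul_nonneg (norm_nonneg _) (lipNorm_nonneg T)) (by simp [hT.2]) fun x y => ?_
  rw [Pi.smul_apply, Pi.smul_apply, ← smul_sub, norm_smul, mul_assoc]
  gcongr
  exact norm_sub_le_lipNorm_mul hT x y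

lemma lipNumericalIndex_le {c : ℝ} (hT : T ∈ LipZero X) (h1 : lipNorm T = 1)
    (hc : lipNumericalRadius 𝕜 T ≤ c) : lipNumericalIndex 𝕜 X ≤ c := by
  refine le_trans (csInf_le ⟨0, ?_⟩ ⟨T, hT, h1, rfl⟩) hc
  rintro r ⟨S, -, -, rfl⟩
  exact lipNumericalRadius_nonneg S

lemma lipNumericalIndex_mul_lipNorm_le (hT : T ∈ LipZero X) :
    lipNumericalIndex 𝕜 X * lipNorm T ≤ lipNumericalRadius 𝕜 T := by
  rcases (lipNorm_nonneg T).eq_or_lt with h0 | hpos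
  · rw [← h0, mul_zero]
    exact lipNumericalRadius_nonneg T
  set a : 𝕜 := (((lipNorm T)⁻¹ : ℝ) : 𝕜) with ha
  have hna : ‖a‖ = (lipNorm T)⁻¹ := by
    rw [ha, RCLike.norm_ofReal, abs_of_pos (inv_pos.2 hpos)]
  have hS := smul_mem_lipZero hT a
  have hsub : ∀ x y, (a • T) x - (a • T) y = a • (T x - T y) := fun x y => by
    simp [smul_sub]
  have hS1 : lipNorm (a • T) = 1 := by
    apply le_antisymm
    · refine lipNorm_le zero_le_one fun x y => ?_
      rw [hsub, norm_smul, hna, inv_mul_le_iff₀ hpos, one_mul]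
      exact norm_sub_le_lipNorm_mul hT x y
    · rw [← mul_inv_cancel₀ hpos.ne', ← le_mul_inv_iff₀ (inv_pos.2 hpos), inv_inv]
      refine lipNorm_le (mul_nonneg (lipNorm_nonneg _) hpos.le) fun x y => ?_
      have := norm_sub_le_lipNorm_mul hS x y
      rw [hsub, norm_smul, hna, inv_mul_le_iff₀ hpos] at this
      linarith
  rw [← le_div_iff₀ hpos]
  refine lipNumericalIndex_le hS hS1 (lipNumericalRadius_le
    (div_nonneg (lipNumericalRadius_nonneg T) hpos.le) fun x y _ f hf hfx => ?_)
  rw [hsub, map_smul, norm_smul, hna, inv_mul_le_iff₀ hpos]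
  have := norm_apply_sub_le_of_mem_dualitySet hT (x := x) (y := y) (f := f)
    ⟨by rw [hfx, hf, sq], by rw [hf, sq]⟩
  refine this.trans_eq ?_
  field_simp

lemma lipNorm_id [Nontrivial X] : lipNorm (id : X → X) = 1 := by
  obtain ⟨x, hx⟩ := exists_ne (0 : X)
  have hid : (id : X → X) ∈ LipZero X := ⟨⟨1, LipschitzWith.id⟩, rfl⟩
  refine le_antisymm (lipNorm_le zero_le_one fun x y => by simp) ?_
  have := norm_sub_le_lipNorm_mul hid x 0
  simp only [id, sub_zero] at this
  nlinarith [norm_pos_iff.2 hx]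

/-- Nontriviality makes the identity a competitor; otherwise the infimum is over the empty set and
takes the default value `0`. -/
lemma le_lipNumericalIndex [Nontrivial X] {c : ℝ}
    (h : ∀ T ∈ LipZero X, lipNorm T = 1 → c ≤ lipNumericalRadius 𝕜 T) :
    c ≤ lipNumericalIndex 𝕜 X := by
  refine le_csInf ⟨_, id, ⟨⟨1, LipschitzWith.id⟩, rfl⟩, lipNorm_id, rfl⟩ ?_
  rintro r ⟨T, hT, h1, rfl⟩
  exact h T hT h1

lemma lipNumericalIndex_of_subsingleton [Subsingleton X] : lipNumericalIndex 𝕜 X = 0 := by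
  have : {r : ℝ | ∃ T ∈ LipZero X, lipNorm T = 1 ∧ r = lipNumericalRadius 𝕜 T} = ∅ := by
    refine Set.eq_empty_of_forall_notMem ?_
    rintro r ⟨T, -, h1, -⟩
    have : lipNorm T ≤ 0 := lipNorm_le le_rfl fun x y => by simp [Subsingleton.elim x y]
    linarith
  rw [lipNumericalIndex, this, Real.sInf_empty]

lemma lipNumericalIndex_nonneg : 0 ≤ lipNumericalIndex 𝕜 X := by
  apply Real.sInf_nonneg
  rintro r ⟨T, -, -, rfl⟩
  exact lipNumericalRadius_nonneg T

lemma exists_norm_eq_one_smul_eq [Nontrivial X] (x : X) :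
    ∃ e : X, ‖e‖ = 1 ∧ x = ((‖x‖ : ℝ) : 𝕜) • e := by
  have hun : ∀ y : X, y ≠ 0 → ‖((‖y‖⁻¹ : ℝ) : 𝕜) • y‖ = 1 := fun y hy => by
    rw [norm_smul, RCLike.norm_ofReal, abs_of_nonneg (by positivity),
      inv_mul_cancel₀ (norm_ne_zero_iff.2 hy)]
  rcases eq_or_ne x 0 with rfl | hx
  · obtain ⟨y, hy⟩ := exists_ne (0 : X)
    exact ⟨_, hun y hy, by simp⟩
  · refine ⟨_, hun x hx, ?_⟩
    rw [smul_smul, ← RCLike.ofReal_mul, mul_inv_cancel₀ (norm_ne_zero_iff.2 hx),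
      RCLike.ofReal_one, one_smul]

end LipschitzNumericalRadius

/-! ### Lush spaces have index one; the scalar field and `C(K)` -/

section Lush

variable (𝕜 : Type*) [RCLike 𝕜] (X : Type*) [NormedAddCommGroup X] [NormedSpace 𝕜 X]

/-- Lushness: every vector is almost a convex combination of rotations of vectors lying in a slice
whose defining functional almost norms another prescribed vector. -/
def IsLush : Prop :=
  ∀ (u v : X) (η : ℝ), 0 < η → ∃ f : StrongDual 𝕜 X, ‖f‖ ≤ 1 ∧ (1 - η) * ‖v‖ ≤ ‖f v‖ ∧
    ∃ (s : Finset ℕ) (w : ℕ → X), ∑ i ∈ s, w i = u ∧ ∑ i ∈ s, ‖w i‖ ≤ (1 + η) * ‖u‖ ∧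
      ∀ i ∈ s, (1 - η) * ‖w i‖ ≤ ‖f (w i)‖

variable {𝕜 X}

/-- Telescoping along the polygonal path from `y` with increments `w i`. -/
lemma norm_apply_sub_le_sum {T : X → X} {f : StrongDual 𝕜 X} {K : ℝ} (s : Finset ℕ) (w : ℕ → X)
    (h : ∀ i ∈ s, ∀ y, ‖f (T (y + w i) - T y)‖ ≤ K * ‖w i‖) (y : X) :
    ‖f (T (y + ∑ i ∈ s, w i) - T y)‖ ≤ K * ∑ i ∈ s, ‖w i‖ := by
  induction s using Finset.induction_on with
  | empty => simp
  | insert a s ha ih =>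
    rw [Finset.sum_insert ha, Finset.sum_insert ha]
    have h1 := ih fun i hi => h i (Finset.mem_insert_of_mem hi)
    have h2 := h a (Finset.mem_insert_self a s) (y + ∑ i ∈ s, w i)
    have e : f (T (y + (w a + ∑ i ∈ s, w i)) - T y)
        = f (T (y + ∑ i ∈ s, w i + w a) - T (y + ∑ i ∈ s, w i))
          + f (T (y + ∑ i ∈ s, w i) - T y) := by
      rw [← map_add, sub_add_sub_cancel]
      congr 3
      abel
    rw [e, mul_add]
    exact (norm_add_le _ _).trans (add_le_add h2 h1)

/-- Lushness is applied to `u = x - y` and `v = Tx - Ty`. The estimate for functionals of the unit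
ball bounds each increment `w i`, telescoping adds these bounds, and `η → 0` is taken before `α →
0`. -/
lemma IsLush.lipNorm_le_lipNumericalRadius (hX : IsLush 𝕜 X) {T : X → X} (hT : T ∈ LipZero X) :
    lipNorm T ≤ lipNumericalRadius 𝕜 T := by
  set c := lipNumericalRadius 𝕜 T with hc
  set L := lipNorm T with hL
  have hc0 : 0 ≤ c := lipNumericalRadius_nonneg T
  have hL0 : 0 ≤ L := lipNorm_nonneg T
  refine lipNorm_le hc0 fun x y => ?_
  have key : ∀ α : ℝ, 0 < α → α * c < 1 → ∀ η : ℝ, 0 < η → (1 - η) * ‖T x - T y‖ ≤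
      (((1 + α ^ 2 * L ^ 2) / (1 - α * c) - 1 + η) / α) * ((1 + η) * ‖x - y‖) := by
    intro α hα hαc η hη
    obtain ⟨f, hf, hfv, s, w, hsum, hle, hw⟩ := hX (x - y) (T x - T y) η hη
    have hK : 0 ≤ ((1 + α ^ 2 * L ^ 2) / (1 - α * c) - 1 + η) / α := by
      have : 1 ≤ (1 + α ^ 2 * L ^ 2) / (1 - α * c) := by
        rw [le_div_iff₀ (by linarith)]
        nlinarith [mul_nonneg hα.le hc0, sq_nonneg (α * L)]
      exact div_nonneg (by linarith) hα.le
    -- Subtract `(1 - η) ‖w i‖ ≤ ‖f (w i)‖` from the first-order estimate and divide by `α`.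
    have hstep : ∀ i ∈ s, ∀ z, ‖f (T (z + w i) - T z)‖ ≤
        ((1 + α ^ 2 * L ^ 2) / (1 - α * c) - 1 + η) / α * ‖w i‖ := by
      intro i hi z
      have h1 := norm_apply_add_mul_norm_apply_le hT hL.ge hc.ge hα.le hαc hf (z + w i) z
      rw [add_sub_cancel_left] at h1
      have h2 := hw i hi
      rw [div_mul_eq_mul_div, le_div_iff₀ hα]
      linarith
    have h := norm_apply_sub_le_sum s w hstep y
    rw [hsum, add_sub_cancel] at h
    exact hfv.trans (h.trans (by gcongr))
  refine le_mul_of_forall_add_mul_le (L := L) fun α hα hαc => ?_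
  have h1 : Filter.Tendsto (fun η : ℝ => (1 - η) * ‖T x - T y‖) (nhdsWithin 0 (Set.Ioi 0))
      (nhds ((1 - 0) * ‖T x - T y‖)) :=
    ((by fun_prop : Continuous fun η : ℝ => (1 - η) * ‖T x - T y‖).tendsto 0).mono_left
      nhdsWithin_le_nhds
  have h2 : Filter.Tendsto (fun η : ℝ => (((1 + α ^ 2 * L ^ 2) / (1 - α * c) - 1 + η) / α)
      * ((1 + η) * ‖x - y‖)) (nhdsWithin 0 (Set.Ioi 0))
      (nhds ((((1 + α ^ 2 * L ^ 2) / (1 - α * c) - 1 + 0) / α) * ((1 + 0) * ‖x - y‖))) :=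
    ((by fun_prop : Continuous fun η : ℝ => (((1 + α ^ 2 * L ^ 2) / (1 - α * c) - 1 + η) / α)
      * ((1 + η) * ‖x - y‖)).tendsto 0).mono_left nhdsWithin_le_nhds
  have h3 := le_of_tendsto_of_tendsto h1 h2
    (Filter.eventually_of_mem self_mem_nhdsWithin fun η hη => key α hα hαc η hη)
  rw [sub_zero, one_mul, add_zero, add_zero, one_mul, div_mul_eq_mul_div, le_div_iff₀ hα] at h3
  linarith

lemma IsLush.lipNumericalIndex_eq_one [Nontrivial X] (hX : IsLush 𝕜 X) :
    lipNumericalIndex 𝕜 X = 1 := by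
  refine le_antisymm ?_ (le_lipNumericalIndex fun T hT h1 => ?_)
  · have hid : (id : X → X) ∈ LipZero X := ⟨⟨1, LipschitzWith.id⟩, rfl⟩
    exact lipNumericalIndex_le hid lipNorm_id
      ((lipNumericalRadius_le_lipNorm hid).trans_eq lipNorm_id)
  · rw [← h1]
    exact hX.lipNorm_le_lipNumericalRadius hT

lemma isLush_self : IsLush 𝕜 𝕜 := by
  intro u v η hη
  refine ⟨ContinuousLinearMap.id 𝕜 𝕜, ContinuousLinearMap.norm_id_le, ?_, {0}, fun _ => u,
    by simp, ?_, ?_⟩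
  · simp only [ContinuousLinearMap.id_apply]
    nlinarith [norm_nonneg v]
  · simp only [Finset.sum_singleton]
    nlinarith [norm_nonneg u]
  · intro i _
    simp only [ContinuousLinearMap.id_apply]
    nlinarith [norm_nonneg u]

/-- The functional is evaluation at a point `τ₀` where `|v|` is maximal. Near `τ₀` the function `u`
is altered by `±b` so that two pieces summing to `u` both almost attain their norms at `τ₀`, while
away from `τ₀` they remain proportional to `u`. -/
lemma isLush_continuousMap {K : Type*} [TopologicalSpace K] [CompactSpace K] [Nonempty K] :
    IsLush 𝕜 C(K, 𝕜) := by
  intro u v η hη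
  obtain ⟨τ₀, hτ₀⟩ : ∃ τ₀, ‖v‖ = ‖v τ₀‖ := by
    obtain ⟨τ₀, -, h⟩ := isCompact_univ.exists_isMaxOn Set.univ_nonempty
      (f := fun τ => ‖v τ‖) (by fun_prop)
    exact ⟨τ₀, le_antisymm ((ContinuousMap.norm_le _ (norm_nonneg _)).2 fun τ => h (Set.mem_univ τ))
      (v.norm_coe_le_norm τ₀)⟩
  refine ⟨ContinuousMap.evalCLM 𝕜 τ₀, ContinuousLinearMap.opNorm_le_bound _ zero_le_one fun g => ?_,
    ?_, ?_⟩
  · simpa using g.norm_coe_le_norm τ₀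
  · simp only [ContinuousMap.evalCLM_apply, hτ₀]
    nlinarith [norm_nonneg (v τ₀)]
  rcases eq_or_ne u 0 with rfl | hu
  · exact ⟨∅, fun _ => 0, by simp, by simp, by simp⟩
  set d := ‖u‖ with hd
  have hdpos : 0 < d := norm_pos_iff.2 hu
  obtain ⟨e, he, hue⟩ := RCLike.exists_norm_mul_eq_self (u τ₀)
  set r := ‖u τ₀‖ with hr
  have hrd : r ≤ d := u.norm_coe_le_norm τ₀
  have hr0 : 0 ≤ r := norm_nonneg _
  -- With `u τ₀ = r e`, the pieces take the values `t e` and `(r - t) e` at `τ₀`. The midpoint `t`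
  -- gives `t - r = d - t`, so the two moduli add up to `d`; the ratio `s = t / d` splits `u` in the
  -- same proportion elsewhere.
  obtain ⟨t, ht⟩ : ∃ t, t = (d + r) / 2 := ⟨_, rfl⟩
  obtain ⟨s, hs⟩ : ∃ s, s = t / d := ⟨_, rfl⟩
  have hsd : s * d = t := by rw [hs]; field_simp
  have hs0 : 0 ≤ s := by rw [hs, ht]; positivity
  have hs1 : s ≤ 1 := by rw [hs, div_le_one hdpos]; linarith
  -- A bump built from `u` itself: it is `1` at `τ₀` and vanishes where `u` differs from `u τ₀` by
  -- at least `η d`.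
  let χ : K → ℝ := fun τ => max 0 (1 - ‖u τ - u τ₀‖ / (η * d))
  have hχc : Continuous χ := by fun_prop
  have hχ0 : ∀ τ, 0 ≤ χ τ := fun τ => le_max_left _ _
  have hχ1 : ∀ τ, χ τ ≤ 1 := fun τ => max_le zero_le_one (by
    have : 0 ≤ ‖u τ - u τ₀‖ / (η * d) := by positivity
    linarith)
  have hχu : ∀ τ, χ τ * ‖u τ - u τ₀‖ ≤ η * d := by
    intro τ
    rcases le_total ‖u τ - u τ₀‖ (η * d) with h | h
    · calc χ τ * ‖u τ - u τ₀‖ ≤ 1 * (η * d) := by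
            gcongr
            exact hχ1 τ
        _ = _ := one_mul _
    · have : χ τ = 0 := max_eq_left (by
        have : 1 ≤ ‖u τ - u τ₀‖ / (η * d) := by rwa [one_le_div (by positivity)]
        linarith)
      rw [this, zero_mul]
      positivity
  have hχτ₀ : χ τ₀ = 1 := by simp [χ]
  let b : C(K, 𝕜) := ⟨fun τ => (χ τ : 𝕜) * (((t - s * r : ℝ) : 𝕜) * e),
    (RCLike.continuous_ofReal.comp hχc).mul continuous_const⟩
  have bound : ∀ (a m : ℝ), 0 ≤ a → ∀ τ, ‖(1 - (χ τ : 𝕜)) * (a : 𝕜) * u τ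
      + (χ τ : 𝕜) * ((a : 𝕜) * (u τ - u τ₀) + (m : 𝕜) * e)‖ ≤
      (1 - χ τ) * (a * d) + a * (η * d) + χ τ * |m| := by
    intro a m ha τ
    have h1 : ‖(1 - (χ τ : 𝕜))‖ = 1 - χ τ := by
      rw [← RCLike.ofReal_one, ← RCLike.ofReal_sub, RCLike.norm_ofReal,
        abs_of_nonneg (by linarith [hχ1 τ])]
    have h2 : ‖(χ τ : 𝕜)‖ = χ τ := by rw [RCLike.norm_ofReal, abs_of_nonneg (hχ0 τ)]
    have h3 : ‖(a : 𝕜)‖ = a := by rw [RCLike.norm_ofReal, abs_of_nonneg ha]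
    calc _ ≤ ‖(1 - (χ τ : 𝕜)) * (a : 𝕜) * u τ‖ + ‖(χ τ : 𝕜)‖ * (‖(a : 𝕜) * (u τ - u τ₀)‖
          + ‖(m : 𝕜) * e‖) := by
          refine (norm_add_le _ _).trans ?_
          rw [norm_mul (χ τ : 𝕜)]
          gcongr
          exact norm_add_le _ _
      _ = (1 - χ τ) * (a * ‖u τ‖) + a * (χ τ * ‖u τ - u τ₀‖) + χ τ * |m| := by
          simp only [norm_mul, h1, h2, h3, he, RCLike.norm_ofReal]
          ring
      _ ≤ _ := by
          have : 0 ≤ 1 - χ τ := by linarith [hχ1 τ]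
          have h5 := mul_le_mul_of_nonneg_left (hχu τ) ha
          have h6 : (1 - χ τ) * (a * ‖u τ‖) ≤ (1 - χ τ) * (a * d) := by
            gcongr
            exact u.norm_coe_le_norm τ
          linarith
  have hw0 : ‖(s : 𝕜) • u + b‖ ≤ (1 + η) * t := by
    refine (ContinuousMap.norm_le _ (by rw [ht]; positivity)).2 fun τ => ?_
    have h := bound s t hs0 τ
    rw [abs_of_nonneg (by rw [ht]; positivity)] at h
    have e1 : ((s : 𝕜) • u + b) τ = (1 - (χ τ : 𝕜)) * (s : 𝕜) * u τ
      + (χ τ : 𝕜) * ((s : 𝕜) * (u τ - u τ₀) + (t : 𝕜) * e) := by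
      simp only [ContinuousMap.add_apply, ContinuousMap.smul_apply, smul_eq_mul, b,
        ContinuousMap.coe_mk]
      rw [← hue]
      push_cast
      ring
    rw [e1]
    refine h.trans_eq ?_
    rw [mul_left_comm s, hsd]
    ring
  have hw1 : ‖((1 - s : ℝ) : 𝕜) • u - b‖ ≤ (1 + η) * (d - t) := by
    refine (ContinuousMap.norm_le _ (mul_nonneg (by positivity) (by linarith))).2 fun τ => ?_
    have h := bound (1 - s) (r - t) (by linarith) τ
    rw [abs_of_nonpos (by linarith)] at h
    have e1 : (((1 - s : ℝ) : 𝕜) • u - b) τ = (1 - (χ τ : 𝕜)) * ((1 - s : ℝ) : 𝕜) * u τ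
      + (χ τ : 𝕜) * (((1 - s : ℝ) : 𝕜) * (u τ - u τ₀) + ((r - t : ℝ) : 𝕜) * e) := by
      simp only [ContinuousMap.sub_apply, ContinuousMap.smul_apply, smul_eq_mul, b,
        ContinuousMap.coe_mk]
      rw [← hue]
      push_cast
      ring
    rw [e1]
    refine h.trans_eq ?_
    have h4 : (1 - s) * d = d - t := by rw [sub_mul, hsd, one_mul]
    rw [mul_left_comm (1 - s), h4]
    have : d - t = t - r := by rw [ht]; ring
    rw [neg_sub, ← this]
    ring
  have hb : b τ₀ = ((t - s * r : ℝ) : 𝕜) * e := by simp [b, hχτ₀]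
  have hv0 : ‖((s : 𝕜) • u + b) τ₀‖ = t := by
    have : ((s : 𝕜) • u + b) τ₀ = (t : 𝕜) * e := by
      rw [ContinuousMap.add_apply, ContinuousMap.smul_apply, hb, ← hue]
      push_cast
      rw [smul_eq_mul]
      ring
    rw [this, norm_mul, he, mul_one, RCLike.norm_ofReal, abs_of_nonneg (by rw [ht]; positivity)]
  have hv1 : ‖(((1 - s : ℝ) : 𝕜) • u - b) τ₀‖ = d - t := by
    have : (((1 - s : ℝ) : 𝕜) • u - b) τ₀ = ((r - t : ℝ) : 𝕜) * e := by
      rw [ContinuousMap.sub_apply, ContinuousMap.smul_apply, hb, ← hue]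
      push_cast
      rw [smul_eq_mul]
      ring
    rw [this, norm_mul, he, mul_one, RCLike.norm_ofReal, abs_of_nonpos (by linarith), ht]
    ring
  -- This is `(1 - η)(1 + η) ≤ 1`; for `η ≥ 1` the left side is nonpositive.
  have main : ∀ A B : ℝ, 0 ≤ A → 0 ≤ B → A ≤ (1 + η) * B → (1 - η) * A ≤ B := by
    intro A B hA hB h
    rcases le_total 1 η with h1 | h1
    · nlinarith
    · nlinarith [mul_nonneg (sq_nonneg η) hB]
  refine ⟨Finset.range 2, fun i => if i = 0 then (s : 𝕜) • u + b else ((1 - s : ℝ) : 𝕜) • u - b,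
    ?_, ?_, ?_⟩
  · simp only [Finset.sum_range_succ, Finset.sum_range_zero, zero_add, if_true, one_ne_zero,
      if_false]
    push_cast
    rw [sub_smul, one_smul]
    abel
  · simp only [Finset.sum_range_succ, Finset.sum_range_zero, zero_add, if_true, one_ne_zero,
      if_false]
    linarith
  · intro i hi
    simp only [ContinuousMap.evalCLM_apply]
    split_ifs
    · rw [hv0]
      exact main _ _ (norm_nonneg _) (by rw [ht]; positivity) hw0
    · rw [hv1]
      exact main _ _ (norm_nonneg _) (by linarith) hw1

end Lush

/-! ### Lushness of `L₁` -/

section LushL1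

variable {𝕜 : Type*} [RCLike 𝕜]

/-- The unimodular phase of a scalar, with value `1` at `0`. -/
noncomputable def phase (z : 𝕜) : 𝕜 := if z = 0 then 1 else z / (‖z‖ : 𝕜)

lemma norm_phase (z : 𝕜) : ‖phase z‖ = 1 := by
  unfold phase
  split_ifs with h
  · simp
  · simp [h]

lemma phase_mul_norm (z : 𝕜) : phase z * (‖z‖ : 𝕜) = z := by
  unfold phase
  split_ifs with h
  · simp [h]
  · have : (‖z‖ : 𝕜) ≠ 0 := by simpa using h
    field_simp

lemma conj_phase_mul (z : 𝕜) : (starRingEnd 𝕜) (phase z) * z = (‖z‖ : 𝕜) := by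
  nth_rewrite 2 [← phase_mul_norm z]
  rw [← mul_assoc, RCLike.conj_mul, norm_phase]
  simp

lemma measurable_phase : Measurable (phase : 𝕜 → 𝕜) := by
  unfold phase
  refine Measurable.ite (measurableSet_singleton 0) measurable_const ?_
  exact measurable_id.div (RCLike.measurable_ofReal.comp measurable_norm)

/-- A finite measurable quantization of the unit circle. -/
lemma exists_measurable_quantization {η : ℝ} (hη : 0 < η) :
    ∃ (N : ℕ) (e : ℕ → 𝕜) (k : 𝕜 → ℕ), Measurable k ∧ (∀ z, k z ≤ N) ∧ (∀ i, ‖e i‖ = 1) ∧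
      ∀ z, ‖z‖ = 1 → ‖z - e (k z)‖ ≤ η := by
  obtain ⟨t, hts, htf, hcov⟩ := Metric.finite_approx_of_totallyBounded
    (isCompact_sphere (0 : 𝕜) 1).totallyBounded η hη
  set l := htf.toFinset.toList with hl
  -- The padding value `1` keeps every `e i` unimodular, including indices beyond the list.
  set e : ℕ → 𝕜 := fun i => l.getD i 1 with he
  have hmem : ∀ z, z ∈ l ↔ z ∈ t := fun z => by simp [hl]
  refine ⟨l.length, e, SimpleFunc.nearestPtInd e l.length,
    (SimpleFunc.nearestPtInd e l.length).measurable, fun z => ?_, fun i => ?_, fun z hz => ?_⟩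
  · exact SimpleFunc.nearestPtInd_le e _ z
  · rcases lt_or_ge i l.length with h | h
    · simp only [he, List.getD_eq_getElem l 1 h]
      simpa using hts ((hmem _).1 (List.getElem_mem h))
    · simp only [he, List.getD_eq_default l 1 h, norm_one]
  · obtain ⟨y, hyt, hy⟩ := Set.mem_iUnion₂.1 (hcov (by simpa using hz : z ∈ Metric.sphere (0 : 𝕜) 1))
    obtain ⟨i, hi, hiy⟩ := List.mem_iff_getElem.1 ((hmem y).2 hyt)
    have h1 := SimpleFunc.edist_nearestPt_le e z hi.le
    have hey : e i = y := by simp only [he, List.getD_eq_getElem l 1 hi, hiy]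
    rw [hey, SimpleFunc.nearestPt, SimpleFunc.map_apply, edist_dist, edist_dist,
      ENNReal.ofReal_le_ofReal_iff dist_nonneg, dist_comm, dist_comm y, dist_eq_norm] at h1
    exact h1.trans (le_of_lt hy)

variable {Ω : Type*} [MeasurableSpace Ω] {μ : Measure Ω}

/-- Integration against a measurable function bounded by one, as a functional on `L¹`. -/
noncomputable def integralMulCLM (φ : Ω → 𝕜) (hφ : Measurable φ) (hφ1 : ∀ ω, ‖φ ω‖ ≤ 1) :
    StrongDual 𝕜 (Lp 𝕜 1 μ) :=
  LinearMap.mkContinuous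
    { toFun := fun h => ∫ ω, φ ω * h ω ∂μ
      map_add' := fun g h => by
        rw [← integral_add ((L1.integrable_coeFn g).bdd_mul hφ.aestronglyMeasurable
            (Filter.Eventually.of_forall hφ1))
          ((L1.integrable_coeFn h).bdd_mul hφ.aestronglyMeasurable
            (Filter.Eventually.of_forall hφ1))]
        refine integral_congr_ae ?_
        filter_upwards [Lp.coeFn_add g h] with ω hω
        rw [hω, Pi.add_apply, mul_add]
      map_smul' := fun a h => by
        rw [RingHom.id_apply, smul_eq_mul, ← integral_const_mul]
        refine integral_congr_ae ?_
        filter_upwards [Lp.coeFn_smul a h] with ω hω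
        rw [hω, Pi.smul_apply, smul_eq_mul]
        ring }
    1 fun h => by
      simp only [LinearMap.coe_mk, AddHom.coe_mk, one_mul]
      rw [L1.norm_eq_integral_norm]
      refine (norm_integral_le_integral_norm _).trans
        (integral_mono_of_nonneg (Filter.Eventually.of_forall fun ω => norm_nonneg _)
          (L1.integrable_coeFn h).norm (Filter.Eventually.of_forall fun ω => ?_))
      simp only [norm_mul]
      exact mul_le_of_le_one_left (norm_nonneg _) (hφ1 ω)

lemma integralMulCLM_apply (φ : Ω → 𝕜) (hφ : Measurable φ) (hφ1 : ∀ ω, ‖φ ω‖ ≤ 1)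
    (h : Lp 𝕜 1 μ) : integralMulCLM φ hφ hφ1 h = ∫ ω, φ ω * h ω ∂μ := rfl

lemma coeFn_finset_sum_Lp {ι E : Type*} [NormedAddCommGroup E] {p : ℝ≥0∞} (s : Finset ι)
    (w : ι → Lp E p μ) : ∀ᵐ ω ∂μ, (∑ i ∈ s, w i) ω = ∑ i ∈ s, w i ω := by
  classical
  induction s using Finset.induction_on with
  | empty =>
    filter_upwards [Lp.coeFn_zero E p μ] with ω hω
    exact hω
  | insert a s ha ih =>
    rw [Finset.sum_insert ha]
    filter_upwards [ih, Lp.coeFn_add (w a) (∑ i ∈ s, w i)] with ω h1 h2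
    rw [h2, Pi.add_apply, h1, Finset.sum_insert ha]

/-- Integration against the conjugate phase `φ` of `v` norms `v` exactly. Cutting `u` along the
level sets of the quantized phase of `φ u` gives disjointly supported pieces, whose norms add, and
on each of which `φ u` is within `η |u|` of a fixed rotation of `|u|`. The functional is explicit,
so no duality theorem, and hence no σ-finiteness, enters. -/
lemma isLush_L1 : IsLush 𝕜 (Lp 𝕜 1 μ) := by
  intro u v η hη
  have hvm : Measurable v := (Lp.stronglyMeasurable v).measurable
  have hum : Measurable u := (Lp.stronglyMeasurable u).measurable
  set φ : Ω → 𝕜 := fun ω => (starRingEnd 𝕜) (phase (v ω)) with hφdef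
  have hφ : Measurable φ := RCLike.continuous_conj.measurable.comp (measurable_phase.comp hvm)
  have hφ1 : ∀ ω, ‖φ ω‖ = 1 := fun ω => by rw [hφdef, RCLike.norm_conj, norm_phase]
  refine ⟨integralMulCLM φ hφ fun ω => (hφ1 ω).le,
    LinearMap.mkContinuous_norm_le _ zero_le_one _, ?_, ?_⟩
  · have : integralMulCLM φ hφ (fun ω => (hφ1 ω).le) v = ((‖v‖ : ℝ) : 𝕜) := by
      rw [integralMulCLM_apply, L1.norm_eq_integral_norm, ← integral_ofReal]
      refine integral_congr_ae (Filter.Eventually.of_forall fun ω => ?_)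
      exact conj_phase_mul (v ω)
    rw [this, RCLike.norm_ofReal, abs_norm]
    nlinarith [norm_nonneg v]
  obtain ⟨N, e, k, hk, hkN, he, hke⟩ := exists_measurable_quantization (𝕜 := 𝕜) hη
  set κ : Ω → ℕ := fun ω => k (phase (φ ω * u ω)) with hκ
  have hκm : Measurable κ := hk.comp (measurable_phase.comp (hφ.mul hum))
  have hA : ∀ i, MeasurableSet (κ ⁻¹' {i}) := fun i => hκm (measurableSet_singleton i)
  have hui := L1.integrable_coeFn u
  have hint : ∀ i, Integrable ((κ ⁻¹' {i}).indicator u) μ := fun i => hui.indicator (hA i)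
  have hw : ∀ i, ((hint i).toL1 : Lp 𝕜 1 μ) =ᵐ[μ] (κ ⁻¹' {i}).indicator u :=
    fun i => (hint i).coeFn_toL1
  have hnorm : ∀ i, ‖((hint i).toL1 : Lp 𝕜 1 μ)‖ = ∫ ω in κ ⁻¹' {i}, ‖u ω‖ ∂μ := by
    intro i
    rw [L1.norm_eq_integral_norm, ← integral_indicator (hA i)]
    refine integral_congr_ae ?_
    filter_upwards [hw i] with ω hω
    rw [hω, norm_indicator_eq_indicator_norm]
  refine ⟨Finset.range (N + 1), fun i => (hint i).toL1, ?_, ?_, fun i _ => ?_⟩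
  · refine Lp.ext ?_
    have hall : ∀ᵐ ω ∂μ, ∀ i, ((hint i).toL1 : Lp 𝕜 1 μ) ω = (κ ⁻¹' {i}).indicator u ω :=
      ae_all_iff.2 hw
    filter_upwards [coeFn_finset_sum_Lp (Finset.range (N + 1))
      fun i => ((hint i).toL1 : Lp 𝕜 1 μ), hall] with ω h1 h2
    rw [h1, Finset.sum_congr rfl fun i _ => h2 i, Finset.sum_eq_single (κ ω)]
    · simp
    · intro i _ hi
      exact Set.indicator_of_notMem (by simpa using hi.symm) _
    · intro h
      exact absurd (Finset.mem_range.2 (Nat.lt_succ_of_le (hkN _))) h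
  · simp only [hnorm]
    rw [← integral_biUnion_finset _ (fun i _ => hA i)
      (fun i _ j _ hij => Disjoint.preimage _ (by simpa using hij))
      (fun i _ => hui.norm.integrableOn), L1.norm_eq_integral_norm]
    have h0 : 0 ≤ ∫ ω, ‖u ω‖ ∂μ := integral_nonneg fun ω => norm_nonneg _
    refine (setIntegral_le_integral hui.norm
      (Filter.Eventually.of_forall fun ω => norm_nonneg _)).trans ?_
    nlinarith
  · rw [integralMulCLM_apply, hnorm]
    have e1 : ∫ ω, φ ω * ((hint i).toL1 : Lp 𝕜 1 μ) ω ∂μ = ∫ ω in κ ⁻¹' {i}, φ ω * u ω ∂μ := by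
      rw [← integral_indicator (hA i)]
      refine integral_congr_ae ?_
      filter_upwards [hw i] with ω hω
      rw [hω]
      by_cases h : ω ∈ κ ⁻¹' {i} <;> simp [h]
    have hφu : Integrable (fun ω => φ ω * u ω) μ := hui.bdd_mul hφ.aestronglyMeasurable
      (Filter.Eventually.of_forall fun ω => (hφ1 ω).le)
    have e2 : ‖∫ ω in κ ⁻¹' {i}, (φ ω * u ω - e i * (‖u ω‖ : 𝕜)) ∂μ‖ ≤
        ∫ ω in κ ⁻¹' {i}, η * ‖u ω‖ ∂μ := by
      refine norm_integral_le_of_norm_le (hui.norm.const_mul η).integrableOn ?_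
      refine (ae_restrict_iff' (hA i)).2 (Filter.Eventually.of_forall fun ω hω => ?_)
      have h1 : φ ω * u ω = phase (φ ω * u ω) * (‖u ω‖ : 𝕜) := by
        nth_rewrite 1 [← phase_mul_norm (φ ω * u ω)]
        rw [norm_mul, hφ1, one_mul]
      have h2 := hke (phase (φ ω * u ω)) (norm_phase _)
      have h3 : k (phase (φ ω * u ω)) = i := hω
      rw [h3] at h2
      rw [h1, ← sub_mul, norm_mul, RCLike.norm_ofReal, abs_norm]
      gcongr
    have hof : Integrable (fun ω => (‖u ω‖ : 𝕜)) μ := hui.norm.ofReal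
    rw [integral_sub hφu.integrableOn (hof.const_mul (e i)).integrableOn, integral_const_mul,
      integral_const_mul, integral_ofReal, norm_sub_rev] at e2
    have h4 : 0 ≤ ∫ ω in κ ⁻¹' {i}, ‖u ω‖ ∂μ := integral_nonneg fun ω => norm_nonneg _
    have h5 := norm_sub_norm_le (e i * ((∫ ω in κ ⁻¹' {i}, ‖u ω‖ ∂μ : ℝ) : 𝕜))
      (∫ ω in κ ⁻¹' {i}, φ ω * u ω ∂μ)
    rw [norm_mul, he, one_mul, RCLike.norm_ofReal, abs_of_nonneg h4] at h5
    rw [e1]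
    linarith

end LushL1

/-! ### Numerical radius through normalized norming functionals -/

section NormingFunctionals

variable {𝕜 : Type*} [RCLike 𝕜] {X : Type*} [NormedAddCommGroup X] [NormedSpace 𝕜 X] {T : X → X}

lemma lipNumericalRadius_le_of_norming {c : ℝ} (hc : 0 ≤ c)
    (h : ∀ x y : X, x ≠ y → ∀ f : StrongDual 𝕜 X, ‖f‖ ≤ 1 → f (x - y) = ((‖x - y‖ : ℝ) : 𝕜) →
      ‖f (T x - T y)‖ ≤ c * ‖x - y‖) :
    lipNumericalRadius 𝕜 T ≤ c := by
  refine lipNumericalRadius_le hc fun x y hxy f hf hfx => ?_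
  have hpos : 0 < ‖x - y‖ := norm_pos_iff.2 (sub_ne_zero.2 hxy)
  have hn : ‖((‖x - y‖⁻¹ : ℝ) : 𝕜)‖ = ‖x - y‖⁻¹ := by
    rw [RCLike.norm_ofReal, abs_of_pos (inv_pos.2 hpos)]
  have := h x y hxy (((‖x - y‖⁻¹ : ℝ) : 𝕜) • f)
    (by rw [norm_smul, hn, hf, inv_mul_cancel₀ hpos.ne'])
    (by
      rw [smul_apply, hfx, smul_eq_mul, ← RCLike.ofReal_mul]
      congr 1
      field_simp)
  rw [smul_apply, norm_smul, hn, inv_mul_le_iff₀ hpos] at this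
  linarith

lemma norm_apply_sub_le_of_norm_le_one (hT : T ∈ LipZero X) {x y : X} {f : StrongDual 𝕜 X}
    (hf : ‖f‖ ≤ 1) (hxy : f (x - y) = ((‖x - y‖ : ℝ) : 𝕜)) :
    ‖f (T x - T y)‖ ≤ lipNumericalRadius 𝕜 T * ‖x - y‖ := by
  rcases eq_or_ne x y with rfl | hne
  · simp
  have hpos : 0 < ‖x - y‖ := norm_pos_iff.2 (sub_ne_zero.2 hne)
  refine norm_apply_sub_le_of_norming hT (le_antisymm hf ?_) hxy
  have := f.le_opNorm (x - y)
  rw [hxy, RCLike.norm_ofReal, abs_norm] at this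
  exact le_of_mul_le_mul_right (by linarith) hpos

end NormingFunctionals

/-! ### Essentially bounded functions: norms, gluing and near constancy -/

section LpTop

variable {Ω : Type*} [MeasurableSpace Ω] {ν : Measure Ω} {X : Type*} [NormedAddCommGroup X]

lemma Lp_top_norm_le_of_ae {h : Lp X ∞ ν} {C : ℝ} (hC : 0 ≤ C) (hh : ∀ᵐ ω ∂ν, ‖h ω‖ ≤ C) :
    ‖h‖ ≤ C := by
  rw [Lp.norm_def, eLpNorm_exponent_top]
  exact ENNReal.toReal_le_of_le_ofReal hC (eLpNormEssSup_le_of_ae_bound hh)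

lemma Lp_top_ae_norm_le (h : Lp X ∞ ν) : ∀ᵐ ω ∂ν, ‖h ω‖ ≤ ‖h‖ := by
  have hfin := Lp.eLpNorm_ne_top h
  filter_upwards [ae_le_eLpNormEssSup (f := h) (μ := ν)] with ω hω
  rw [Lp.norm_def]
  rw [← eLpNorm_exponent_top] at hω
  rw [← toReal_enorm]
  exact ENNReal.toReal_mono hfin hω

lemma exists_mem_of_ae {B : Set Ω} (hB : ν B ≠ 0) {P : Ω → Prop} (h : ∀ᵐ ω ∂ν, P ω) :
    ∃ ω ∈ B, P ω :=
  ((frequently_ae_mem_iff.2 hB).and_eventually h).exists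

/-- Replacing an essentially bounded function by a constant on a measurable set. -/
lemma exists_Lp_top_piecewise {B : Set Ω} (hB : MeasurableSet B) (x : X) (h : Lp X ∞ ν) :
    ∃ k : Lp X ∞ ν, (∀ᵐ ω ∂ν, ω ∈ B → k ω = x) ∧ ∀ᵐ ω ∂ν, ω ∉ B → k ω = h ω := by
  classical
  have hm : MemLp (B.piecewise (fun _ => x) h) ∞ ν := by
    refine memLp_top_of_bound (StronglyMeasurable.piecewise hB stronglyMeasurable_const
      (Lp.stronglyMeasurable h)).aestronglyMeasurable (max ‖x‖ ‖h‖) ?_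
    filter_upwards [Lp_top_ae_norm_le h] with ω hω
    by_cases hωB : ω ∈ B
    · simp [hωB]
    · simp [hωB, hω]
  refine ⟨hm.toLp, ?_, ?_⟩
  · filter_upwards [hm.coeFn_toLp] with ω hω hωB
    simp [hω, hωB]
  · filter_upwards [hm.coeFn_toLp] with ω hω hωB
    simp [hω, hωB]

lemma Lp_top_norm_eq_of_ae {B : Set Ω} (hB : ν B ≠ 0) {k : Lp X ∞ ν} {C : ℝ}
    (h1 : ∀ᵐ ω ∂ν, ω ∈ B → ‖k ω‖ = C) (h2 : ∀ᵐ ω ∂ν, ω ∉ B → ‖k ω‖ ≤ C) : ‖k‖ = C := by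
  obtain ⟨ω, hωB, hω1, hω2⟩ := exists_mem_of_ae hB (h1.and (Lp_top_ae_norm_le k))
  rw [hω1 hωB] at hω2
  refine le_antisymm (Lp_top_norm_le_of_ae ((hω1 hωB) ▸ norm_nonneg _) ?_) hω2
  filter_upwards [h1, h2] with ω h1 h2
  by_cases h : ω ∈ B
  · exact (h1 h).le
  · exact h2 h

/-- A strongly measurable function is nearly constant on a subset of positive measure. -/
lemma exists_subset_norm_sub_le {E : Type*} [NormedAddCommGroup E] {h : Ω → E}
    (hh : StronglyMeasurable h) {A : Set Ω} (hA : MeasurableSet A) (hA0 : ν A ≠ 0) {δ : ℝ}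
    (hδ : 0 < δ) :
    ∃ B ⊆ A, MeasurableSet B ∧ ν B ≠ 0 ∧ ∃ c : E, ∀ ω ∈ B, ‖h ω - c‖ ≤ δ := by
  obtain ⟨D, hD, hsub⟩ := hh.isSeparable_range
  by_contra! hcon
  refine hA0 ?_
  have hcov : A ⊆ ⋃ c ∈ D, A ∩ {ω | ‖h ω - c‖ ≤ δ} := by
    intro ω hω
    obtain ⟨c, hcD, hc⟩ := Metric.mem_closure_iff.1 (hsub ⟨ω, rfl⟩) δ hδ
    refine Set.mem_iUnion₂.2 ⟨c, hcD, hω, ?_⟩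
    rw [dist_eq_norm] at hc
    exact hc.le
  refine measure_mono_null hcov ((measure_biUnion_null_iff hD).2 fun c _ => ?_)
  by_contra h0
  obtain ⟨ω, hω, hω'⟩ := hcon _ Set.inter_subset_left
    (hA.inter (measurableSet_le (hh.sub stronglyMeasurable_const).norm.measurable
      measurable_const)) h0 c
  exact absurd hω.2 (not_le.2 hω')

end LpTop

/-! ### Averaging operators -/

section Average

variable {𝕜 : Type*} [RCLike 𝕜] {Ω : Type*} [MeasurableSpace Ω] {ν : Measure Ω}
  {X : Type*} [NormedAddCommGroup X] [NormedSpace 𝕜 X] [CompleteSpace X]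

/-- The averaging operator over a set of finite positive measure. -/
lemma exists_average_clm {B : Set Ω} (hB0 : ν B ≠ 0) (hBfin : ν B ≠ ∞) :
    ∃ P : Lp X ∞ ν →L[𝕜] X, ∀ (k : Lp X ∞ ν) (c : X) (δ : ℝ),
      (∀ᵐ ω ∂ν, ω ∈ B → ‖k ω - c‖ ≤ δ) → ‖P k - c‖ ≤ δ := by
  let _ : NormedSpace ℝ X := NormedSpace.restrictScalars ℝ 𝕜 X
  have : IsScalarTower ℝ 𝕜 X := inferInstance
  have hfin : Fact (ν B < ∞) := ⟨hBfin.lt_top⟩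
  have hpos : 0 < ν.real B := ENNReal.toReal_pos hB0 hBfin
  have hint : ∀ k : Lp X ∞ ν, IntegrableOn k B ν := fun k =>
    ((Lp.memLp k).restrict B).integrable le_top
  let P₀ : Lp X ∞ ν →ₗ[𝕜] X :=
    { toFun := fun k => (ν.real B)⁻¹ • ∫ ω in B, k ω ∂ν
      map_add' := fun g h => by
        rw [← smul_add, ← integral_add (hint g) (hint h)]
        congr 1
        exact integral_congr_ae (ae_restrict_of_ae (Lp.coeFn_add g h))
      map_smul' := fun a h => by
        rw [RingHom.id_apply, smul_comm, ← integral_smul a]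
        congr 1
        exact integral_congr_ae (ae_restrict_of_ae (Lp.coeFn_smul a h)) }
  have key : ∀ (k : Lp X ∞ ν) (c : X) (δ : ℝ),
      (∀ᵐ ω ∂ν, ω ∈ B → ‖k ω - c‖ ≤ δ) → ‖P₀ k - c‖ ≤ δ := by
    intro k c δ h
    have e : P₀ k - c = (ν.real B)⁻¹ • ∫ ω in B, (k ω - c) ∂ν := by
      rw [integral_sub (hint k) (integrable_const c), setIntegral_const, smul_sub, smul_smul,
        inv_mul_cancel₀ hpos.ne', one_smul]
      rfl
    have h1 := norm_setIntegral_le_of_norm_le_const_ae' hBfin.lt_top h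
    rw [e, norm_smul, Real.norm_of_nonneg (by positivity), inv_mul_le_iff₀ hpos]
    linarith
  refine ⟨P₀.mkContinuous 1 fun k => ?_, key⟩
  have := key k 0 ‖k‖ (by
    filter_upwards [Lp_top_ae_norm_le k] with ω hω _
    simpa using hω)
  simpa using this

end Average

/-! ### Upper bound for the index of `L∞(ν, X)` -/

section LpTopIndex

variable {𝕜 : Type*} [RCLike 𝕜] {Ω : Type*} [MeasurableSpace Ω] {ν : Measure Ω}
  {X : Type*} [NormedAddCommGroup X] [NormedSpace 𝕜 X]

/-- A functional on `Lp X ∞ ν` need not act pointwise, but `norm_sub_add_smul_le` is a norm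
inequality with a constant scalar `u`. It passes to the essential supremum, and the limit `α → 0⁺`
then recovers the radius. -/
lemma lipNumericalRadius_compLp_le {T : X → X} (hT : T ∈ LipZero X) {L : ℝ≥0}
    (hL : LipschitzWith L T) :
    lipNumericalRadius 𝕜 (hL.compLp hT.2 : Lp X ∞ ν → Lp X ∞ ν) ≤ lipNumericalRadius 𝕜 T := by
  set c := lipNumericalRadius 𝕜 T with hc
  have hc0 : 0 ≤ c := lipNumericalRadius_nonneg T
  refine lipNumericalRadius_le_of_norming hc0 fun f g _ F hF hFfg => ?_
  refine le_mul_of_forall_add_mul_le (L := lipNorm T) fun α hα hαc => ?_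
  obtain ⟨u, hu, hu'⟩ := exists_norm_add_mul_eq hα.le (F (f - g))
    (F (hL.compLp hT.2 f - hL.compLp hT.2 g))
  rw [hFfg, RCLike.norm_ofReal, abs_norm] at hu'
  rw [← hu', ← hFfg, ← smul_eq_mul u, ← map_smul, ← map_add]
  refine (F.le_of_opNorm_le hF _).trans ?_
  rw [one_mul]
  have hK : 0 ≤ (1 + α ^ 2 * lipNorm T ^ 2) / (1 - α * c) := by
    have : 0 < 1 - α * c := by linarith
    positivity
  refine Lp_top_norm_le_of_ae (mul_nonneg hK (norm_nonneg _)) ?_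
  filter_upwards [Lp_top_ae_norm_le (f - g), Lp.coeFn_sub f g,
    Lp.coeFn_sub (hL.compLp hT.2 f) (hL.compLp hT.2 g), hL.coeFn_compLp hT.2 f,
    hL.coeFn_compLp hT.2 g, Lp.coeFn_smul u (hL.compLp hT.2 f - hL.compLp hT.2 g),
    Lp.coeFn_add (f - g) (u • (hL.compLp hT.2 f - hL.compLp hT.2 g))] with ω h1 h2 h3 h4 h5 h6 h7
  rw [h7, Pi.add_apply, h6, Pi.smul_apply, h3, Pi.sub_apply, h4, h5, h2, Pi.sub_apply]
  rw [h2, Pi.sub_apply] at h1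
  refine (norm_sub_add_smul_le hT le_rfl hc.ge hα.le hαc hu (f ω) (g ω)).trans ?_
  gcongr

lemma lipNumericalIndex_Lp_top_le [Nontrivial X] (hν : ν ≠ 0) :
    lipNumericalIndex 𝕜 (Lp X ∞ ν) ≤ lipNumericalIndex 𝕜 X := by
  refine le_lipNumericalIndex fun T hT h1 => ?_
  have hL : LipschitzWith 1 T := LipschitzWith.of_dist_le_mul fun x y => by
    simpa [dist_eq_norm, h1] using norm_sub_le_lipNorm_mul hT x y
  have hmem : (hL.compLp hT.2 : Lp X ∞ ν → Lp X ∞ ν) ∈ LipZero (Lp X ∞ ν) := by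
    refine mem_lipZero_of_norm_sub_le zero_le_one ?_ fun f g => ?_
    · refine Lp.ext ?_
      filter_upwards [hL.coeFn_compLp hT.2 (0 : Lp X ∞ ν), Lp.coeFn_zero X ∞ ν] with ω h2 h3
      rw [h2, Function.comp_apply, h3]
      exact hT.2
    · simpa using hL.norm_compLp_sub_le hT.2 f g
  refine lipNumericalIndex_le hmem (le_antisymm (lipNorm_le zero_le_one fun f g => ?_) ?_)
    (lipNumericalRadius_compLp_le hT hL)
  · simpa using hL.norm_compLp_sub_le hT.2 f g
  rw [← h1]
  refine lipNorm_le (lipNorm_nonneg _) fun x y => ?_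
  have huniv : ν Set.univ ≠ 0 := by simpa using hν
  -- Constant functions show that composition does not lower the Lipschitz norm.
  obtain ⟨f, hf, -⟩ := exists_Lp_top_piecewise (ν := ν) MeasurableSet.univ x 0
  obtain ⟨g, hg, -⟩ := exists_Lp_top_piecewise (ν := ν) MeasurableSet.univ y 0
  have e1 : ‖f - g‖ = ‖x - y‖ := by
    refine Lp_top_norm_eq_of_ae huniv ?_ (by simp)
    filter_upwards [hf, hg, Lp.coeFn_sub f g] with ω h2 h3 h4 h5
    rw [h4, Pi.sub_apply, h2 h5, h3 h5]
  have e2 : ‖hL.compLp hT.2 f - hL.compLp hT.2 g‖ = ‖T x - T y‖ := by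
    refine Lp_top_norm_eq_of_ae huniv ?_ (by simp)
    filter_upwards [hf, hg, Lp.coeFn_sub (hL.compLp hT.2 f) (hL.compLp hT.2 g),
      hL.coeFn_compLp hT.2 f, hL.coeFn_compLp hT.2 g] with ω h2 h3 h4 h6 h7 h5
    rw [h4, Pi.sub_apply, h6, h7, Function.comp_apply, Function.comp_apply, h2 h5, h3 h5]
  rw [← e1, ← e2]
  exact norm_sub_le_lipNorm_mul hmem f g

end LpTopIndex

/-! ### Lower bound for the index of `L∞(ν, X)`, and the main theorem -/

section LpTopLower

variable {𝕜 : Type*} [RCLike 𝕜] {Ω : Type*} [MeasurableSpace Ω] {ν : Measure Ω} [SigmaFinite ν]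
  {X : Type*} [NormedAddCommGroup X] [NormedSpace 𝕜 X] [CompleteSpace X]

/-- If `T` moves apart on `B` two functions that are constant on `B` and attain their distance
there, then `T` induces a Lipschitz self-map of `X` with controlled numerical radius. -/
lemma lipNumericalIndex_mul_le_of_const_on {T : Lp X ∞ ν → Lp X ∞ ν} (hT : T ∈ LipZero (Lp X ∞ ν))
    {B : Set Ω} (hB : MeasurableSet B) (hB0 : ν B ≠ 0) {p q : Lp X ∞ ν} {a b : X}
    (hp : ∀ᵐ ω ∂ν, ω ∈ B → p ω = a) (hq : ∀ᵐ ω ∂ν, ω ∈ B → q ω = b)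
    (hab : ‖a - b‖ = ‖p - q‖) {M : ℝ}
    (hM : ∀ᵐ ω ∂ν, ω ∈ B → M * ‖p - q‖ < ‖(T p - T q) ω‖) :
    lipNumericalIndex 𝕜 X * M ≤ lipNumericalRadius 𝕜 T := by
  have hpq : p ≠ q := by
    rintro rfl
    obtain ⟨ω, hωB, h1, h2⟩ := exists_mem_of_ae hB0 (hM.and (Lp.coeFn_zero X ∞ ν))
    have h3 := h1 hωB
    rw [sub_self, sub_self, h2] at h3
    simp at h3
  set d := ‖p - q‖ with hd
  have hdpos : 0 < d := norm_pos_iff.2 (sub_ne_zero.2 hpq)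
  have hn0 : 0 ≤ lipNumericalIndex 𝕜 X := lipNumericalIndex_nonneg
  set ωT := lipNumericalRadius 𝕜 T with hωT
  have hωT0 : 0 ≤ ωT := lipNumericalRadius_nonneg T
  suffices H : ∀ δ : ℝ, 0 < δ → lipNumericalIndex 𝕜 X * (M * d - 2 * δ) ≤ ωT * d by
    refine le_of_mul_le_mul_right (le_of_forall_pos_le_add fun ε hε => ?_) hdpos
    have h1 := H (ε / (2 * (lipNumericalIndex 𝕜 X + 1))) (by positivity)
    have h2 : lipNumericalIndex 𝕜 X * (2 * (ε / (2 * (lipNumericalIndex 𝕜 X + 1)))) ≤ ε := by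
      rw [mul_div_assoc', mul_div_assoc', div_le_iff₀ (by positivity)]
      nlinarith
    nlinarith
  intro δ hδ
  obtain ⟨B₁, hB₁B, hB₁, hB₁0, c, hc⟩ :=
    exists_subset_norm_sub_le (Lp.stronglyMeasurable (T p - T q)) hB hB0 hδ
  -- σ-finiteness enters here: averaging needs a set of finite positive measure.
  obtain ⟨B₂, hB₂, hB₂B₁, hB₂0, hB₂fin⟩ :=
    Measure.exists_subset_measure_lt_top hB₁ (pos_iff_ne_zero.2 hB₁0)
  obtain ⟨P, hP⟩ := exists_average_clm (𝕜 := 𝕜) (X := X) hB₂0.ne' hB₂fin.ne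
  have hP1 : ‖P‖ ≤ 1 := P.opNorm_le_bound zero_le_one fun k => by
    have := hP k 0 ‖k‖ (by
      filter_upwards [Lp_top_ae_norm_le k] with ω hω _
      simpa using hω)
    simpa using this
  have hPle : ∀ k, ‖P k‖ ≤ ‖k‖ := fun k => by simpa using P.le_of_opNorm_le hP1 k
  -- `Φ x` will be `x` on `B` and `q + lam x (p - q)` off `B`. Since `lam` is `1/d`-Lipschitz, the
  -- part off `B` moves by at most `‖x - y‖`, so `Φ` is isometric; `lam a = 1` and `lam b = 0` yield
  -- `Φ a = p` and `Φ b = q`.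
  let lam : X → ℝ := fun x => min 1 (‖x - b‖ / d)
  have hlam : ∀ x y, |lam x - lam y| * d ≤ ‖x - y‖ := by
    intro x y
    have h1 : |lam x - lam y| ≤ |‖x - b‖ / d - ‖y - b‖ / d| := by
      refine (abs_min_sub_min_le_max _ _ _ _).trans ?_
      simp
    have h2 : |‖x - b‖ - ‖y - b‖| ≤ ‖x - y‖ := by
      simpa using abs_norm_sub_norm_le (x - b) (y - b)
    rw [← sub_div, abs_div, abs_of_pos hdpos, le_div_iff₀ hdpos] at h1
    exact h1.trans h2
  choose Φ hΦB hΦBc using fun x : X =>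
    exists_Lp_top_piecewise hB x (q + ((lam x : ℝ) : 𝕜) • (p - q))
  have hΦsub : ∀ x y, ∀ᵐ ω ∂ν, ω ∈ B → (Φ x - Φ y) ω = x - y := by
    intro x y
    filter_upwards [hΦB x, hΦB y, Lp.coeFn_sub (Φ x) (Φ y)] with ω h1 h2 h3 hω
    rw [h3, Pi.sub_apply, h1 hω, h2 hω]
  have hΦnorm : ∀ x y, ‖Φ x - Φ y‖ = ‖x - y‖ := by
    intro x y
    refine Lp_top_norm_eq_of_ae hB0 ?_ ?_
    · filter_upwards [hΦsub x y] with ω h hω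
      rw [h hω]
    · set h := ((lam x - lam y : ℝ) : 𝕜) • (p - q) with hh
      have e : q + ((lam x : ℝ) : 𝕜) • (p - q) - (q + ((lam y : ℝ) : 𝕜) • (p - q)) = h := by
        rw [hh, RCLike.ofReal_sub, sub_smul]
        abel
      have hle : ‖h‖ ≤ ‖x - y‖ := by
        rw [hh, norm_smul, RCLike.norm_ofReal]
        exact hlam x y
      filter_upwards [hΦBc x, hΦBc y, Lp.coeFn_sub (Φ x) (Φ y), Lp_top_ae_norm_le h,
        Lp.coeFn_sub (q + ((lam x : ℝ) : 𝕜) • (p - q)) (q + ((lam y : ℝ) : 𝕜) • (p - q))]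
        with ω h1 h2 h3 h4 h5 hω
      rw [h3, Pi.sub_apply, h1 hω, h2 hω, ← Pi.sub_apply, ← h5, e]
      exact h4.trans hle
  have hPΦ : ∀ x y, P (Φ x - Φ y) = x - y := by
    intro x y
    refine sub_eq_zero.1 (norm_le_zero_iff.1 (hP _ _ 0 ?_))
    filter_upwards [hΦsub x y] with ω h hω
    rw [h (hB₁B (hB₂B₁ hω)), sub_self, norm_zero]
  have hΦeq : ∀ (x : X) (k : Lp X ∞ ν), (∀ᵐ ω ∂ν, ω ∈ B → k ω = x) →
      q + ((lam x : ℝ) : 𝕜) • (p - q) = k → Φ x = k := by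
    intro x k h1 h2
    refine Lp.ext ?_
    filter_upwards [hΦB x, hΦBc x, h1] with ω h3 h4 h5
    by_cases hω : ω ∈ B
    · rw [h3 hω, h5 hω]
    · rw [h4 hω, h2]
  have hΦa : Φ a = p := hΦeq a p hp (by simp [lam, hab, hdpos.ne'])
  have hΦb : Φ b = q := hΦeq b q hq (by simp [lam])
  let S : X → X := fun x => P (T (Φ x)) - P (T (Φ 0))
  have hSsub : ∀ x y, S x - S y = P (T (Φ x) - T (Φ y)) := fun x y => by
    simp only [S, map_sub, sub_sub_sub_cancel_right]
  have hS : S ∈ LipZero X := by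
    refine mem_lipZero_of_norm_sub_le (lipNorm_nonneg T) (sub_self _) fun x y => ?_
    rw [hSsub, ← hΦnorm x y]
    exact (hPle _).trans (norm_sub_le_lipNorm_mul hT _ _)
  have hSω : lipNumericalRadius 𝕜 S ≤ ωT := by
    refine lipNumericalRadius_le_of_norming hωT0 fun x y _ f hf hfx => ?_
    -- Because `P (Φ x - Φ y) = x - y` and `Φ` is isometric, `f ∘ P` norms `Φ x - Φ y` whenever `f`
    -- norms `x - y`.
    have h1 : ‖f.comp P‖ ≤ 1 := (f.opNorm_comp_le P).trans
      (mul_le_one₀ hf (norm_nonneg _) hP1)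
    have h2 := norm_apply_sub_le_of_norm_le_one hT (x := Φ x) (y := Φ y) h1
      (by rw [ContinuousLinearMap.comp_apply, hPΦ, hΦnorm, hfx])
    rwa [ContinuousLinearMap.comp_apply, hΦnorm, ← hSsub] at h2
  have hSab : M * d - 2 * δ ≤ lipNorm S * d := by
    have h1 := norm_sub_le_lipNorm_mul hS a b
    rw [hSsub, hΦa, hΦb, hab] at h1
    have h2 : ‖P (T p - T q) - c‖ ≤ δ :=
      hP _ _ _ (Filter.Eventually.of_forall fun ω hω => hc ω (hB₂B₁ hω))
    obtain ⟨ω, hω, h3⟩ := exists_mem_of_ae hB₁0 hM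
    have h4 := h3 (hB₁B hω)
    have h5 := hc ω hω
    have h6 := norm_le_norm_sub_add ((T p - T q) ω) c
    have h7 := norm_le_norm_sub_add c (P (T p - T q))
    rw [norm_sub_rev] at h7
    linarith
  calc lipNumericalIndex 𝕜 X * (M * d - 2 * δ) ≤ lipNumericalIndex 𝕜 X * (lipNorm S * d) := by
        gcongr
    _ = lipNumericalIndex 𝕜 X * lipNorm S * d := by ring
    _ ≤ ωT * d := by
        gcongr
        exact (lipNumericalIndex_mul_lipNorm_le hS).trans hSω

/-- The distance need not be attained on `B`: a detour through an intermediate function reduces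
to the case where it is. -/
lemma lipNumericalIndex_mul_le_of_eqOn_const [Nontrivial X] {T : Lp X ∞ ν → Lp X ∞ ν}
    (hT : T ∈ LipZero (Lp X ∞ ν)) {B : Set Ω} (hB : MeasurableSet B) (hB0 : ν B ≠ 0)
    {f g : Lp X ∞ ν} {x₀ y₀ : X} (hf : ∀ᵐ ω ∂ν, ω ∈ B → f ω = x₀)
    (hg : ∀ᵐ ω ∂ν, ω ∈ B → g ω = y₀) {M : ℝ}
    (hM : ∀ᵐ ω ∂ν, ω ∈ B → M * ‖f - g‖ < ‖(T f - T g) ω‖) :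
    lipNumericalIndex 𝕜 X * M ≤ lipNumericalRadius 𝕜 T := by
  have hrd : ‖x₀ - y₀‖ ≤ ‖f - g‖ := by
    obtain ⟨ω, hω, ⟨h1, h2⟩, h3, h4⟩ := exists_mem_of_ae hB0
      ((hf.and hg).and ((Lp_top_ae_norm_le (f - g)).and (Lp.coeFn_sub f g)))
    rwa [h4, Pi.sub_apply, h1 hω, h2 hω] at h3
  rcases (norm_nonneg (f - g)).eq_or_lt with hd0 | hdpos
  · exact lipNumericalIndex_mul_le_of_const_on hT hB hB0 hf hg
      (le_antisymm hrd (hd0 ▸ norm_nonneg _)) hM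
  obtain ⟨e, he, hxe⟩ := exists_norm_eq_one_smul_eq (𝕜 := 𝕜) (x₀ - y₀)
  set d := ‖f - g‖ with hd
  set r := ‖x₀ - y₀‖ with hr
  have hr0 : 0 ≤ r := norm_nonneg _
  -- The intermediate function `m` equals `y₀ + t e` on `B` and `g + (t/d)(f - g)` off `B`.
  -- Overshooting `x₀` along `e` to the midpoint `t` of `r` and `d` gives `t - r = d - t`, so both
  -- legs attain their distances `t` and `d - t` on `B`.
  obtain ⟨t, ht⟩ : ∃ t, t = (d + r) / 2 := ⟨_, rfl⟩
  obtain ⟨s, hs⟩ : ∃ s, s = t / d := ⟨_, rfl⟩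
  have hsd : s * d = t := by rw [hs]; field_simp
  have hs0 : 0 ≤ s := by rw [hs, ht]; positivity
  have hs1 : s ≤ 1 := by rw [hs, div_le_one hdpos]; linarith
  obtain ⟨m, hmB, hmBc⟩ := exists_Lp_top_piecewise hB (y₀ + (t : 𝕜) • e)
    (g + (s : 𝕜) • (f - g))
  have hzy : ‖y₀ + (t : 𝕜) • e - y₀‖ = t := by
    rw [add_sub_cancel_left, norm_smul, he, RCLike.norm_ofReal, mul_one,
      abs_of_nonneg (by rw [ht]; positivity)]
  have hxz : ‖x₀ - (y₀ + (t : 𝕜) • e)‖ = d - t := by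
    have : x₀ - (y₀ + (t : 𝕜) • e) = ((r - t : ℝ) : 𝕜) • e := by
      rw [← sub_sub, RCLike.ofReal_sub, sub_smul, ← hxe]
    rw [this, norm_smul, he, RCLike.norm_ofReal, mul_one, abs_of_nonpos (by linarith), ht]
    ring
  have hmg : ‖m - g‖ = t := by
    refine Lp_top_norm_eq_of_ae hB0 ?_ ?_
    · filter_upwards [hmB, hg, Lp.coeFn_sub m g] with ω h1 h2 h3 hω
      rw [h3, Pi.sub_apply, h1 hω, h2 hω, hzy]
    · have hle : ‖(s : 𝕜) • (f - g)‖ ≤ t := by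
        rw [norm_smul, RCLike.norm_ofReal, abs_of_nonneg hs0, ← hd, hsd]
      filter_upwards [hmBc, Lp.coeFn_sub m g, Lp.coeFn_add g ((s : 𝕜) • (f - g)),
        Lp_top_ae_norm_le ((s : 𝕜) • (f - g))] with ω h1 h2 h3 h4 hω
      rw [h2, Pi.sub_apply, h1 hω, h3, Pi.add_apply, add_sub_cancel_left]
      exact h4.trans hle
  have hfm : ‖f - m‖ = d - t := by
    refine Lp_top_norm_eq_of_ae hB0 ?_ ?_
    · filter_upwards [hmB, hf, Lp.coeFn_sub f m] with ω h1 h2 h3 hω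
      rw [h3, Pi.sub_apply, h1 hω, h2 hω, hxz]
    · have e1 : f - (g + (s : 𝕜) • (f - g)) = ((1 - s : ℝ) : 𝕜) • (f - g) := by
        rw [RCLike.ofReal_sub, RCLike.ofReal_one, sub_smul, one_smul]
        abel
      have hle : ‖f - (g + (s : 𝕜) • (f - g))‖ ≤ d - t := by
        rw [e1, norm_smul, RCLike.norm_ofReal, abs_of_nonneg (by linarith), ← hd, sub_mul, hsd,
          one_mul]
      filter_upwards [hmBc, Lp.coeFn_sub f m, Lp.coeFn_sub f (g + (s : 𝕜) • (f - g)),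
        Lp_top_ae_norm_le (f - (g + (s : 𝕜) • (f - g)))] with ω h1 h2 h3 h4 hω
      rw [h2, Pi.sub_apply, h1 hω, ← Pi.sub_apply, ← h3]
      exact h4.trans hle
  -- The two legs have total length `d`, so by the triangle inequality `T` stretches at least one of
  -- them by more than `M` at almost every point of `B`; one of `A₁`, `A₂` thus has positive
  -- measure.
  set A₁ := B ∩ {ω | M * ‖f - m‖ < ‖(T f - T m) ω‖} with hA₁
  set A₂ := B ∩ {ω | M * ‖m - g‖ < ‖(T m - T g) ω‖} with hA₂
  have hA₁m : MeasurableSet A₁ := hB.inter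
    (measurableSet_lt measurable_const (Lp.stronglyMeasurable _).norm.measurable)
  have hA₂m : MeasurableSet A₂ := hB.inter
    (measurableSet_lt measurable_const (Lp.stronglyMeasurable _).norm.measurable)
  by_cases h₁ : ν A₁ = 0
  · by_cases h₂ : ν A₂ = 0
    · exfalso
      obtain ⟨ω, hω, ⟨h1, h2⟩, ⟨h3, h4⟩, h5, h6⟩ := exists_mem_of_ae hB0
        (((measure_eq_zero_iff_ae_notMem.1 h₁).and (measure_eq_zero_iff_ae_notMem.1 h₂)).and
          ((hM.and (Lp.coeFn_sub (T f) (T g))).and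
            ((Lp.coeFn_sub (T f) (T m)).and (Lp.coeFn_sub (T m) (T g)))))
      have h7 : ‖(T f - T m) ω‖ ≤ M * ‖f - m‖ := not_lt.1 fun h => h1 ⟨hω, h⟩
      have h8 : ‖(T m - T g) ω‖ ≤ M * ‖m - g‖ := not_lt.1 fun h => h2 ⟨hω, h⟩
      have h9 := h3 hω
      have h10 := norm_sub_le_norm_sub_add_norm_sub (T f ω) (T m ω) (T g ω)
      rw [h5, Pi.sub_apply, hfm] at h7
      rw [h6, Pi.sub_apply, hmg] at h8
      rw [h4, Pi.sub_apply] at h9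
      linarith
    · refine lipNumericalIndex_mul_le_of_const_on hT hA₂m h₂ (p := m) (q := g) (M := M)
        (hmB.mono fun ω h hω => h hω.1) (hg.mono fun ω h hω => h hω.1) (by rw [hzy, hmg])
        (Filter.Eventually.of_forall fun ω hω => hω.2)
  · refine lipNumericalIndex_mul_le_of_const_on hT hA₁m h₁ (p := f) (q := m) (M := M)
      (hf.mono fun ω h hω => h hω.1) (hmB.mono fun ω h hω => h hω.1) (by rw [hxz, hfm])
      (Filter.Eventually.of_forall fun ω hω => hω.2)

/-- A strict inequality survives small perturbations: `f` and `g` are replaced by functions constant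
on a common set of positive measure where `T f - T g` is large. -/
lemma lipNumericalIndex_mul_le_of_lt_lipNorm [Nontrivial X] {T : Lp X ∞ ν → Lp X ∞ ν}
    (hT : T ∈ LipZero (Lp X ∞ ν)) {M : ℝ} (hM0 : 0 ≤ M) (hM : M < lipNorm T) :
    lipNumericalIndex 𝕜 X * M ≤ lipNumericalRadius 𝕜 T := by
  obtain ⟨f, g, -, hfg⟩ := exists_lt_norm_sub_of_lt_lipNorm hM0 hM
  set L := lipNorm T with hL
  have hL0 : 0 ≤ L := lipNorm_nonneg T
  obtain ⟨κ, hκ1, hκ2⟩ := exists_between hfg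
  have hκ0 : 0 ≤ κ := (mul_nonneg hM0 (norm_nonneg _)).trans hκ1.le
  set A := {ω | κ < ‖(T f - T g) ω‖} with hA
  have hAm : MeasurableSet A :=
    measurableSet_lt measurable_const (Lp.stronglyMeasurable _).norm.measurable
  have hA0 : ν A ≠ 0 := by
    intro h0
    refine hκ2.not_ge (Lp_top_norm_le_of_ae hκ0 ?_)
    filter_upwards [measure_eq_zero_iff_ae_notMem.1 h0] with ω hω
    exact not_lt.1 hω
  -- Moving `f` and `g` by `δ` each can raise `M ‖f - g‖` by `2 M δ` and lower the pointwise norm of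
  -- `T f - T g` by `2 L δ`.
  obtain ⟨δ, hδ, hδ'⟩ : ∃ δ : ℝ, 0 < δ ∧ δ * (2 * L + 2 * M) ≤ κ - M * ‖f - g‖ := by
    refine ⟨(κ - M * ‖f - g‖) / (2 * L + 2 * M + 1), div_pos (by linarith) (by linarith), ?_⟩
    rw [div_mul_eq_mul_div, div_le_iff₀ (by linarith)]
    nlinarith
  -- Near constancy is applied to the pair `(f, g)`, so that one set serves both functions.
  obtain ⟨B, hBA, hB, hB0, c, hc⟩ := exists_subset_norm_sub_le
    ((Lp.stronglyMeasurable f).prodMk (Lp.stronglyMeasurable g)) hAm hA0 hδ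
  have hnear : ∀ (h : Lp X ∞ ν) (x : X), (∀ ω ∈ B, ‖h ω - x‖ ≤ δ) →
      ∃ k : Lp X ∞ ν, (∀ᵐ ω ∂ν, ω ∈ B → k ω = x) ∧ ‖k - h‖ ≤ δ := by
    intro h x hx
    obtain ⟨k, hk1, hk2⟩ := exists_Lp_top_piecewise hB x h
    refine ⟨k, hk1, Lp_top_norm_le_of_ae hδ.le ?_⟩
    filter_upwards [hk1, hk2, Lp.coeFn_sub k h] with ω h1 h2 h3
    rw [h3, Pi.sub_apply]
    by_cases hω : ω ∈ B
    · rw [h1 hω, norm_sub_rev]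
      exact hx ω hω
    · rw [h2 hω, sub_self, norm_zero]
      exact hδ.le
  obtain ⟨f', hf', hff'⟩ := hnear f c.1 fun ω hω => (norm_fst_le _).trans (hc ω hω)
  obtain ⟨g', hg', hgg'⟩ := hnear g c.2 fun ω hω => (norm_snd_le _).trans (hc ω hω)
  refine lipNumericalIndex_mul_le_of_eqOn_const hT hB hB0 hf' hg' ?_
  have h1 : ‖f' - g'‖ ≤ ‖f - g‖ + 2 * δ := by
    have : f' - g' = (f - g) + (f' - f) - (g' - g) := by abel
    rw [this]
    linarith [norm_sub_le (f - g + (f' - f)) (g' - g), norm_add_le (f - g) (f' - f)]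
  have h2 : ‖T f' - T f‖ ≤ L * δ := (norm_sub_le_lipNorm_mul hT _ _).trans (by gcongr)
  have h3 : ‖T g' - T g‖ ≤ L * δ := (norm_sub_le_lipNorm_mul hT _ _).trans (by gcongr)
  filter_upwards [Lp_top_ae_norm_le (T f' - T f), Lp_top_ae_norm_le (T g' - T g),
    Lp.coeFn_sub (T f') (T f), Lp.coeFn_sub (T g') (T g), Lp.coeFn_sub (T f') (T g'),
    Lp.coeFn_sub (T f) (T g)] with ω h4 h5 h6 h7 h8 h9 hω
  have h10 : κ < ‖(T f - T g) ω‖ := hBA hω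
  rw [h9, Pi.sub_apply] at h10
  rw [h6, Pi.sub_apply] at h4
  rw [h7, Pi.sub_apply] at h5
  rw [h8, Pi.sub_apply]
  have h11 : T f ω - T g ω = (T f' ω - T g' ω) - (T f' ω - T f ω) + (T g' ω - T g ω) := by abel
  rw [h11] at h10
  have h12 := norm_add_le ((T f' ω - T g' ω) - (T f' ω - T f ω)) (T g' ω - T g ω)
  have h13 := norm_sub_le (T f' ω - T g' ω) (T f' ω - T f ω)
  have h14 : M * ‖f' - g'‖ ≤ M * (‖f - g‖ + 2 * δ) := by gcongr
  linarith

lemma lipNumericalIndex_Lp_top (hν : ν ≠ 0) :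
    lipNumericalIndex 𝕜 (Lp X ∞ ν) = lipNumericalIndex 𝕜 X := by
  rcases subsingleton_or_nontrivial X with hX | hX
  · have : Subsingleton (Lp X ∞ ν) := ⟨fun f g =>
      Lp.ext (Filter.Eventually.of_forall fun ω => Subsingleton.elim _ _)⟩
    rw [lipNumericalIndex_of_subsingleton, lipNumericalIndex_of_subsingleton]
  refine le_antisymm (lipNumericalIndex_Lp_top_le hν) ?_
  have : Nontrivial (Lp X ∞ ν) := by
    have huniv : ν Set.univ ≠ 0 := by simpa using hν
    obtain ⟨x, hx⟩ := exists_ne (0 : X)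
    obtain ⟨f, hf, -⟩ := exists_Lp_top_piecewise (ν := ν) MeasurableSet.univ x 0
    refine ⟨f, 0, fun h => ?_⟩
    obtain ⟨ω, hω, h1, h2⟩ := exists_mem_of_ae huniv (hf.and (Lp.coeFn_zero X ∞ ν))
    have h3 := h1 hω
    rw [h, h2] at h3
    exact hx h3.symm
  refine le_lipNumericalIndex fun T hT h1 => ?_
  refine le_of_forall_pos_le_add fun ε hε => ?_
  set n := lipNumericalIndex 𝕜 X with hn
  have hn0 : 0 ≤ n := lipNumericalIndex_nonneg
  -- The maximum with `0` keeps `M` nonnegative for large `ε`; the divisor `n + 1` avoids dividing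
  -- by a possibly zero index.
  have h2 : max 0 (1 - ε / (n + 1)) < lipNorm T := by
    rw [h1]
    refine max_lt one_pos ?_
    have : 0 < ε / (n + 1) := by positivity
    linarith
  have h3 := lipNumericalIndex_mul_le_of_lt_lipNorm (𝕜 := 𝕜) hT (le_max_left _ _) h2
  have h4 : n * (1 - ε / (n + 1)) ≤ n * max 0 (1 - ε / (n + 1)) := by
    gcongr
    exact le_max_right _ _
  have h5 : n * (ε / (n + 1)) ≤ ε := by
    rw [mul_div_assoc', div_le_iff₀ (by positivity)]
    nlinarith
  linarith

end LpTopLower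

theorem theorem4p10 (𝕜 : Type*) [RCLike 𝕜] :
    (∀ (Ω : Type*) [MeasurableSpace Ω] (ν : Measure Ω) [SigmaFinite ν] (_ : ν ≠ 0)
      (X : Type*) [NormedAddCommGroup X] [NormedSpace 𝕜 X] [CompleteSpace X],
      lipNumericalIndex 𝕜 (Lp X ∞ ν) = lipNumericalIndex 𝕜 X) ∧
    (∀ (K : Type*) [TopologicalSpace K] [CompactSpace K] [T2Space K] [Nonempty K],
      lipNumericalIndex 𝕜 C(K, 𝕜) = 1) ∧
    (∀ (Ω : Type*) [MeasurableSpace Ω] (μ : Measure Ω) (_ : Nontrivial (Lp 𝕜 1 μ)),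
      lipNumericalIndex 𝕜 (Lp 𝕜 1 μ) = 1) ∧
    (∀ (Ω : Type*) [MeasurableSpace Ω] (ν : Measure Ω) [SigmaFinite ν] (_ : ν ≠ 0),
      lipNumericalIndex 𝕜 (Lp 𝕜 ∞ ν) = 1) := by
  refine ⟨?_, ?_, ?_, ?_⟩
  · intro Ω _ ν _ hν X _ _ _
    exact lipNumericalIndex_Lp_top hν
  · intro K _ _ _ _
    exact isLush_continuousMap.lipNumericalIndex_eq_one
  · intro Ω _ μ _
    exact isLush_L1.lipNumericalIndex_eq_one
  · intro Ω _ ν _ hν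
    rw [lipNumericalIndex_Lp_top hν]
    exact isLush_self.lipNumericalIndex_eq_one
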